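/- Conventions. A digraph $\mathbb A=(A;\to)$ is a set $A$ with a binary relation $\to$. It is smooth if every vertex has an out-neighbour and an in-neighbour, symmetric if $a\to b$ implies $b\to a$, bipartite if its vertex set can be partitioned into two (possibly empty) sets neither of which contains both ends of an edge, and it has a loop if $a\to a$ for some $a$. For a subgroup $G\le\operatorname{Aut}(\mathbb A)$, the $n$-orbits of $G$ are the orbits of its componentwise action on $A^n$, and $\mathbb A/G$ is the digraph whose vertices are the $1$-orbits, with an edge from $U$ to $V$ whenever $a\to b$ for some $a\in U$, $b\in V$. A primitive positive (pp) formula is built from atomic formulas (including equalities) by conjunction and existential quantification. A set of relations on $A$ pp-interprets, $1$-dimensionally and with parameters, a relation $R\subseteq C^n$ on a set $C$ if there is a surjective map $h\colon P\to C$ with $P\subseteq A$ such that $P$, the binary relation $\{(x,y)\in P^2: h(x)=h(y)\}$ and the $n$-ary relation $\{(x_1,\dots,x_n)\in P^n:(h(x_1),\dots,h(x_n))\in R\}$ are all definable by pp-formulas over the given relations and the unary relations $\{a\}$, $a\in A$. For a binary relation $\alpha$ on $C$, $\operatorname{OR}(\alpha,\alpha)=\{(a_1,a_2,b_1,b_2)\in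 C^4:(a_1,a_2)\in\alpha\text{ or }(b_1,b_2)\in\alpha\}$. An equivalence relation $\alpha$ on $C$ is proper if $\alpha\neq C^2$. Theorem. Let $\mathbb A=(A;\to)$ be a smooth digraph (finite or infinite) and let $G$ be a subgroup of $\operatorname{Aut}(\mathbb A)$ with finitely many $2$-orbits. Suppose that $\mathbb A/G$ is symmetric and not bipartite. Then - $\mathbb A/G$ has a loop, or - the relation $\to$ together with the $1$-orbits of $G$ $1$-dimensionally pp-interprets with parameters the relation $\operatorname{OR}(\alpha,\alpha)$ for some proper equivalence relation $\alpha$ on some finite set $C$. -/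

import Mathlib

universe u v

/-! ### Relational structures, primitive positive definitions and interpretations -/

/-- A relational structure with domain `A`, given by the set of its (finitary) relations. -/
abbrev RelStr (A : Type u) : Type u := Set (Σ n : ℕ, Set (Fin n → A))

/-- The relational signature of `Γ`: one symbol for each relation of `Γ`. -/
def RelStr.lang {A : Type u} (Γ : RelStr A) : FirstOrder.Language.{0, u} where
  Functions := fun _ => Empty
  Relations := fun n => {R : Set (Fin n → A) // (⟨n, R⟩ : Σ n : ℕ, Set (Fin n → A)) ∈ Γ}

/-- Each symbol of the signature of `Γ` is interpreted by the relation that it names. -/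
instance RelStr.langStructure {A : Type u} (Γ : RelStr A) : Γ.lang.Structure A where
  funMap := fun f => f.elim
  RelMap := fun R x => x ∈ R.1

/-- Primitive positive formulas: built from atomic formulas (equalities included) by conjunction
and existential quantification. -/
inductive IsPrimitivePositive {L : FirstOrder.Language.{0, u}} {ι : Type v} :
    ∀ {n : ℕ}, L.BoundedFormula ι n → Prop
  | atomic {n : ℕ} {φ : L.BoundedFormula ι n} (h : φ.IsAtomic) : IsPrimitivePositive φ
  | inf {n : ℕ} {φ ψ : L.BoundedFormula ι n} (hφ : IsPrimitivePositive φ)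
      (hψ : IsPrimitivePositive ψ) : IsPrimitivePositive (φ ⊓ ψ)
  | ex {n : ℕ} {φ : L.BoundedFormula ι (n + 1)} (h : IsPrimitivePositive φ) :
      IsPrimitivePositive φ.ex

/-- `S` (a relation on `A` with coordinates indexed by `ι`) is pp-definable in `Γ`. -/
def RelStr.PPDefinable {A : Type u} (Γ : RelStr A) {ι : Type v} (S : Set (ι → A)) : Prop :=
  ∃ φ : Γ.lang.Formula ι, IsPrimitivePositive φ ∧ ∀ x : ι → A, x ∈ S ↔ φ.Realize x

/-- The preimage `h⁻¹(R)` of an `n`-ary relation `R` on `B` under the partial map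
`h : A ^ d → B` with domain `dom`, seen as a relation on `A` of arity `n * d`. -/
def interpPreimage {A : Type u} {B : Type v} {d : ℕ} (dom : Set (Fin d → A)) (h : dom → B)
    {n : ℕ} (R : Set (Fin n → B)) : Set (Fin n × Fin d → A) :=
  {x | ∃ y : Fin n → dom, (∀ i j, x (i, j) = (y i : Fin d → A) j) ∧ (fun i => h (y i)) ∈ R}

/-- `Γ` pp-interprets `Δ` in dimension `d`. -/
def RelStr.PPInterprets {A : Type u} {B : Type v} (Γ : RelStr A) (d : ℕ) (Δ : RelStr B) : Prop :=
  1 ≤ d ∧ ∃ (dom : Set (Fin d → A)) (h : dom → B), Function.Surjective h ∧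
    Γ.PPDefinable (interpPreimage dom h (Set.univ : Set (Fin 1 → B))) ∧
    Γ.PPDefinable (interpPreimage dom h {y : Fin 2 → B | y 0 = y 1}) ∧
    ∀ (n : ℕ) (R : Set (Fin n → B)), (⟨n, R⟩ : Σ n : ℕ, Set (Fin n → B)) ∈ Δ →
      Γ.PPDefinable (interpPreimage dom h R)

/-- The expansion of `Γ` by the unary relations `{a}`, for `a` in the domain. -/
def RelStr.withParameters {A : Type u} (Γ : RelStr A) : RelStr A :=
  Γ ∪ Set.range fun a : A => ⟨1, {x | x 0 = a}⟩

/-- `Γ` pp-interprets `Δ` with parameters, in dimension `d`. -/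
def RelStr.PPInterpretsWithParameters {A : Type u} {B : Type v} (Γ : RelStr A) (d : ℕ)
    (Δ : RelStr B) : Prop :=
  Γ.withParameters.PPInterprets d Δ

/-- The `(n + m)`-ary relation `OR(R, S)`: the first `n` coordinates are in `R` or the last `m`
coordinates are in `S`. -/
def relOR {A : Type u} {n m : ℕ} (R : Set (Fin n → A)) (S : Set (Fin m → A)) :
    Set (Fin (n + m) → A) :=
  {x | (fun i => x (Fin.castAdd m i)) ∈ R ∨ (fun j => x (Fin.natAdd n j)) ∈ S}

/-- An equivalence relation as a binary relation. -/
def Setoid.toRel {A : Type u} (α : Setoid A) : Set (Fin 2 → A) := {x | α (x 0) (x 1)}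

/-! ### Digraphs, their automorphisms and orbits -/

namespace Digraph

/-- The edge relation is subdirect: no sources and no sinks. -/
def IsSmooth {A : Type u} (D : Digraph A) : Prop :=
  (∀ a, ∃ b, D.Adj a b) ∧ ∀ b, ∃ a, D.Adj a b

/-- The digraph is a graph: its edge relation is symmetric. -/
def IsSymmetric {A : Type u} (D : Digraph A) : Prop := ∀ a b, D.Adj a b → D.Adj b a

def HasLoop {A : Type u} (D : Digraph A) : Prop := ∃ a, D.Adj a a

/-- There is a partition of the vertices into two (possibly empty) independent sets. -/
def IsBipartite {A : Type u} (D : Digraph A) : Prop :=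
  ∃ c : A → Bool, ∀ a b, D.Adj a b → c a ≠ c b

/-- The quotient digraph modulo an equivalence relation on the vertices. -/
def quot {A : Type u} (D : Digraph A) (s : Setoid A) : Digraph (Quotient s) where
  Adj := fun p q => ∃ a b, Quotient.mk s a = p ∧ Quotient.mk s b = q ∧ D.Adj a b

/-- The automorphism group of a digraph (acting on the vertices by evaluation). -/
abbrev Aut {A : Type u} (D : Digraph A) : Type u := D.Adj ≃r D.Adj

/-- The factor digraph `D / G` on the `1`-orbits of `G`. -/
def orbitDigraph {A : Type u} (D : Digraph A) (G : Subgroup D.Aut) :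
    Digraph (MulAction.orbitRel.Quotient G A) :=
  D.quot (MulAction.orbitRel G A)

/-- `G` has finitely many `n`-orbits, i.e. orbits in its componentwise action on `A ^ n`. -/
def FinitelyManyOrbits {A : Type u} (D : Digraph A) (G : Subgroup D.Aut) (n : ℕ) : Prop :=
  Finite (MulAction.orbitRel.Quotient G (Fin n → A))

/-- The structure on the vertices whose relations are the edge relation and the `1`-orbits
of `G`. -/
def withOrbits {A : Type u} (D : Digraph A) (G : Subgroup D.Aut) : RelStr A :=
  {⟨2, {x | D.Adj (x 0) (x 1)}⟩} ∪
    Set.range fun a : A => ⟨1, {x | x 0 ∈ MulAction.orbit G a}⟩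

end Digraph

/-! Assume that the orbit graph has no loop. The target is then `OR(=, =)` on `Bool`. An invariant
binary relation is a union of 2-orbits, so there are finitely many, and extremal choices among the
pp-definable ones are always possible.

Among the relations whose orbit graph is symmetric, loopless and non-bipartite, take one with the
fewest non-isolated orbits and, subject to that, the most edges between orbits. Edge-maximality
forces a triangle (`Admissible.exists_triangle`); minimality makes every definable proper set of
non-isolated orbits induce a bipartite graph (`Admissible.tame`). In such a finite graph, a maximal
triple of mutually rigid independent sets is a 3-colouring whose unions of two colours are definable
(`Tame.union_mem`, `Tame.exists_threeColoring`).

Back in `A`, enlarge the relation to a maximal one between different colours. Composing it with a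
colour-preserving definable relation shows that equally coloured vertices with a common neighbour
are twins (`MaxRel.out_of_common`). In the bipartite double, each twin class then has exactly one
neighbouring class of each other colour, so the classes form cycles or two-way infinite paths
(`IsTwin.exists_perm`). Finiteness of the set of invariant relations excludes an infinite path, and
sides and colours make the length `2 * n` a multiple of 6. Walks of length `n - 2` reach every class
of the right side except the antipodal one, which defines a blow-up of `K_{n,n}` minus a perfect
matching. Parameters reduce `n` to 3, where a small gadget expresses the disjunction
(`ThreeColors.or_iff`). -/

open FirstOrder FirstOrder.Language in
theorem IsPrimitivePositive.relabel {L : FirstOrder.Language.{0, u}} {ι κ : Type} {n k : ℕ}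
    (g : ι → κ ⊕ Fin n) {φ : L.BoundedFormula ι k} (h : IsPrimitivePositive φ) :
    IsPrimitivePositive (φ.relabel g) := by
  induction h with
  | atomic h => exact .atomic (h.relabel g)
  | inf _ _ h1 h2 => exact .inf h1 h2
  | ex _ h => rw [BoundedFormula.relabel_ex]; exact .ex h

/-! ### Closure properties of pp-definable predicates -/

namespace RelStr

variable {A : Type u} {Γ : RelStr A} {ι : Type}

/-- A predicate on tuples is pp-definable. -/
def PP (Γ : RelStr A) (p : (ι → A) → Prop) : Prop := Γ.PPDefinable {x | p x}

/-- A unary predicate is pp-definable. -/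
def PP1 (Γ : RelStr A) (p : A → Prop) : Prop := ∀ ⦃ι : Type⦄ (i : ι), Γ.PP fun x : ι → A => p (x i)

/-- A binary predicate is pp-definable. -/
def PP2 (Γ : RelStr A) (r : A → A → Prop) : Prop :=
  ∀ ⦃ι : Type⦄ (i j : ι), Γ.PP fun x : ι → A => r (x i) (x j)

open FirstOrder FirstOrder.Language

theorem PP.and {p q : (ι → A) → Prop} (hp : Γ.PP p) (hq : Γ.PP q) : Γ.PP fun x => p x ∧ q x := by
  obtain ⟨φ, hφ, h1⟩ := hp
  obtain ⟨ψ, hψ, h2⟩ := hq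
  refine ⟨φ ⊓ ψ, hφ.inf hψ, fun x => ?_⟩
  have h1 := h1 x
  have h2 := h2 x
  simp only [Set.mem_ofPred_eq] at h1 h2 ⊢
  rw [h1, h2]
  exact BoundedFormula.realize_inf.symm

/-- Indexing by `Option ι` keeps nested quantifiers free of de Bruijn bookkeeping: `none` is the
variable about to be bound. -/
theorem PP.ex {p : (ι → A) → A → Prop}
    (h : Γ.PP fun w : Option ι → A => p (fun i => w (some i)) (w none)) :
    Γ.PP fun x => ∃ a, p x a := by
  obtain ⟨φ, hφ, h⟩ := h
  let g : Option ι → ι ⊕ Fin 1 := fun o => o.elim (Sum.inr 0) Sum.inl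
  refine ⟨(BoundedFormula.relabel g φ : Γ.lang.BoundedFormula ι (0 + 1)).ex, ?_, fun x => ?_⟩
  · exact .ex (hφ.relabel g)
  · refine Iff.trans ?_ BoundedFormula.realize_ex.symm
    refine exists_congr fun a => ?_
    refine Iff.trans ?_ (BoundedFormula.realize_relabel (m := 1) (n := 0) (φ := φ) (g := g)).symm
    refine (h (fun o => o.elim a x)).trans (iff_of_eq ?_)
    unfold Formula.Realize
    congr 1
    · funext o
      cases o <;> rfl
    · exact Subsingleton.elim _ _

theorem PP.of_mem {n : ℕ} {R : Set (Fin n → A)} (hR : (⟨n, R⟩ : Σ n : ℕ, Set (Fin n → A)) ∈ Γ)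
    (f : Fin n → ι) : Γ.PP fun x : ι → A => (fun k => x (f k)) ∈ R := by
  let R' : Γ.lang.Relations n := ⟨R, hR⟩
  refine ⟨R'.formula fun k => .var (f k), .atomic (.rel _ _), fun x => ?_⟩
  exact (Formula.realize_rel (M := A) (R := R') (ts := fun k => .var (f k)) (v := x)).symm

theorem PP.congr {p q : (ι → A) → Prop} (hp : Γ.PP p) (h : ∀ x, p x ↔ q x) : Γ.PP q := by
  rwa [show q = p from funext fun x => propext (h x).symm]

theorem PP1.congr {p q : A → Prop} (hp : Γ.PP1 p) (h : ∀ x, p x ↔ q x) : Γ.PP1 q :=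
  fun _ i => (hp i).congr fun _ => h _

theorem PP2.congr {p q : A → A → Prop} (hp : Γ.PP2 p) (h : ∀ x y, p x y ↔ q x y) : Γ.PP2 q :=
  fun _ i j => (hp i j).congr fun _ => h _ _

theorem PP1.and {p q : A → Prop} (hp : Γ.PP1 p) (hq : Γ.PP1 q) : Γ.PP1 fun x => p x ∧ q x :=
  fun _ i => (hp i).and (hq i)

theorem PP2.flip {r : A → A → Prop} (hr : Γ.PP2 r) : Γ.PP2 fun x y => r y x :=
  fun _ i j => hr j i

theorem PP2.comp {r s : A → A → Prop} (hr : Γ.PP2 r) (hs : Γ.PP2 s) :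
    Γ.PP2 (Relation.Comp r s) :=
  fun _ _ _ => .ex (.and (hr _ _) (hs _ _))

theorem PP1.const (a : A) : Γ.withParameters.PP1 fun x => x = a := fun _ i =>
  PP.of_mem (R := {x | x 0 = a}) (Or.inr ⟨a, rfl⟩) fun _ => i

theorem PP2.left {r : A → A → Prop} (hr : Γ.withParameters.PP2 r) (a : A) :
    Γ.withParameters.PP1 (r a) := fun _ i =>
  (PP.ex (p := fun x b => b = a ∧ r b (x i)) (.and (PP1.const a _) (hr _ _))).congr fun x => by simp

theorem PP2.right {r : A → A → Prop} (hr : Γ.withParameters.PP2 r) (a : A) :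
    Γ.withParameters.PP1 fun x => r x a := PP2.left (PP2.flip hr) a

theorem PP1.of_mem_withParameters {p : A → Prop}
    (h : (⟨1, {x | p (x 0)}⟩ : Σ n : ℕ, Set (Fin n → A)) ∈ Γ) : Γ.withParameters.PP1 p := fun _ i =>
  PP.of_mem (R := {x | p (x 0)}) (Or.inl h) fun _ => i

theorem PP2.of_mem_withParameters {r : A → A → Prop}
    (h : (⟨2, {x | r (x 0) (x 1)}⟩ : Σ n : ℕ, Set (Fin n → A)) ∈ Γ) : Γ.withParameters.PP2 r :=
  fun _ i j => PP.of_mem (R := {x | r (x 0) (x 1)}) (Or.inl h) ![i, j]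

theorem PP.forall_mem {κ : Type*} (s : Finset κ) {p : κ → (ι → A) → Prop} {q : (ι → A) → Prop}
    (hq : Γ.PP q) (hp : ∀ k ∈ s, Γ.PP (p k)) : Γ.PP fun x => q x ∧ ∀ k ∈ s, p k x := by
  classical
  induction s using Finset.induction_on with
  | empty => simpa using hq
  | insert a s ha ih =>
    refine ((ih fun k hk => hp k (Finset.mem_insert_of_mem hk)).and
      (hp a (Finset.mem_insert_self _ _))).congr fun x => ?_
    simp only [Finset.mem_insert, forall_eq_or_imp]
    tauto

end RelStr

/-! ### Interpreting `OR(=, =)` in complements of perfect matchings -/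

theorem interpPreimage_eq {A : Type u} {B : Type v} (p : A → Prop) (e : A → B) {n : ℕ}
    (R : Set (Fin n → B)) :
    interpPreimage {x : Fin 1 → A | p (x 0)} (fun x => e (x.1 0)) R =
      {x | (∀ i, p (x (i, 0))) ∧ (fun i => e (x (i, 0))) ∈ R} := by
  ext x
  constructor
  · rintro ⟨y, h1, h2⟩
    have h3 : ∀ i, x (i, 0) = (y i).1 0 := fun i => h1 i 0
    refine ⟨fun i => ?_, ?_⟩
    · rw [h3]
      exact (y i).2
    · have : (fun i => e (x (i, 0))) = fun i => e ((y i).1 0) := funext fun i => by rw [h3]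
      rw [this]
      exact h2
  · rintro ⟨h1, h2⟩
    refine ⟨fun i => ⟨fun _ => x (i, 0), h1 i⟩, fun i j => ?_, h2⟩
    rw [Subsingleton.elim j 0]

namespace RelStr

variable {A : Type u} {Γ : RelStr A}

/-- A pp-definable set with a two-valued map such that the kernel of the map and the pullback of
`OR(=, =)` are pp-definable yields a one-dimensional pp-interpretation of `OR(=, =)`. -/
theorem pPInterprets_relOR_of_map {p : A → Prop} {e : A → Bool} (he : ∀ b, ∃ x, p x ∧ e x = b)
    (hp : Γ.PP1 p) (hker : Γ.PP2 fun x y => (p x ∧ p y) ∧ e x = e y)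
    (hor : ∀ (ι : Type) (i j k l : ι), Γ.PP fun x : ι → A =>
      (p (x i) ∧ p (x j) ∧ p (x k) ∧ p (x l)) ∧ (e (x i) = e (x j) ∨ e (x k) = e (x l))) :
    Γ.PPInterprets 1
      ({⟨2 + 2, relOR (⊥ : Setoid Bool).toRel (⊥ : Setoid Bool).toRel⟩} : RelStr Bool) := by
  refine ⟨le_rfl, {x | p (x 0)}, fun x => e (x.1 0), fun b => ?_, ?_, ?_, ?_⟩
  · obtain ⟨x, hx, hb⟩ := he b
    exact ⟨⟨fun _ => x, hx⟩, hb⟩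
  · rw [interpPreimage_eq p e]
    exact (hp (0, 0)).congr fun x => by simp
  · rw [interpPreimage_eq p e]
    exact (hker (0, 0) (1, 0)).congr fun x => by simp
  · rintro n R h
    rw [Set.mem_singleton_iff] at h
    obtain ⟨rfl, h⟩ := Sigma.mk.inj h
    rw [eq_of_heq h, interpPreimage_eq p e]
    refine (hor _ (0, 0) (1, 0) (2, 0) (3, 0)).congr fun x => and_congr ?_ Iff.rfl
    rw [Fin.forall_fin_succ (n := 3), Fin.forall_fin_succ, Fin.forall_fin_two]
    exact Iff.rfl

theorem ThreeColors.eq_iff {i j : Fin 3} (hi : i ≠ 2) (hj : j ≠ 2) :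
    (∃ k, i ≠ k ∧ j ≠ k ∧ 2 ≠ k) ↔ i = j := by
  revert i j
  decide

-- The values `v = 1` and `v' = 2` are always available. If `i1 ≠ i2`, then `z = 2`, `v = 1`, `w' =
-- 0`, `v' = 2` are forced, and the last conditions say `i3 = i4`. If `i1 = i2`, then `v = 2` is
-- possible, which allows `v' = 0`, and `w = 2` suits all `i3`, `i4`.
set_option synthInstance.maxHeartbeats 400000 in
set_option synthInstance.maxSize 1000 in
set_option maxRecDepth 100000 in
theorem ThreeColors.or_iff {i1 i2 i3 i4 : Fin 3} (h1 : i1 ≠ 2) (h2 : i2 ≠ 2) (h3 : i3 ≠ 2)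
    (h4 : i4 ≠ 2) : (∃ z v w' v' w, (i1 ≠ z ∧ i2 ≠ z ∧ v ≠ z ∧ v ≠ 0) ∧
        (v ≠ w' ∧ 2 ≠ w' ∧ v' ≠ w' ∧ v' ≠ 1) ∧ v' ≠ w ∧ i3 ≠ w ∧ i4 ≠ w) ↔
        (i1 = i2 ∨ i3 = i4) := by
  revert i1 i2 i3 i4
  decide

/-- A pp-definable bipartite graph which is the blow-up of `K_{3,3}` minus a perfect matching
allows to pp-interpret `OR(=, =)`. -/
theorem pPInterprets_relOR_of_three {Z : A → A → Prop} (hZ : Γ.withParameters.PP2 Z)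
    {T S : Fin 3 → A → Prop} (hT : ∀ i j y, T i y → T j y → i = j)
    (hS : ∀ i j y, S i y → S j y → i = j) (hT0 : ∀ i, ∃ y, T i y) (hS0 : ∀ i, ∃ y, S i y)
    (h : ∀ y z, Z y z ↔ ∃ i j, i ≠ j ∧ T i y ∧ S j z) :
    Γ.withParameters.PPInterprets 1
      ({⟨2 + 2, relOR (⊥ : Setoid Bool).toRel (⊥ : Setoid Bool).toRel⟩} : RelStr Bool) := by
  classical
  choose a ha using hT0
  choose b hb using hS0
  have hZ' : ∀ {i j y z}, T i y → S j z → (Z y z ↔ i ≠ j) := fun {i j y z} hi hj => by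
    rw [h]
    refine ⟨?_, fun hij => ⟨i, j, hij, hi, hj⟩⟩
    rintro ⟨i', j', h1, h2, h3⟩
    rwa [hT _ _ _ hi h2, hS _ _ _ hj h3]
  -- Adjacency to `b 2` cuts the left side down to colours 0 and 1, which `e` tells apart.
  let e : A → Bool := fun y => decide (T 0 y)
  have hp : ∀ {y}, Z y (b 2) ↔ T 0 y ∨ T 1 y := fun {y} => by
    constructor
    · intro hy
      obtain ⟨i, j, h1, h2, h3⟩ := (h _ _).1 hy
      have := (hZ' h2 (hb 2)).1 hy
      fin_cases i
      · exact .inl h2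
      · exact .inr h2
      · exact absurd rfl this
    · rintro (h1 | h1) <;> rw [hZ' h1 (hb 2)] <;> decide
  have he : ∀ {y y'}, Z y (b 2) → Z y' (b 2) → ∀ {i j}, T i y → T j y' → (e y = e y' ↔ i = j) := by
    intro y y' hy hy' i j hi hj
    have key : ∀ {y}, Z y (b 2) → ∀ {i}, T i y → i = if e y = true then 0 else 1 := by
      intro y hy i hi
      by_cases h0 : T 0 y
      · simp [e, h0, hT _ _ _ hi h0]
      · simp [e, h0, hT _ _ _ hi ((hp.1 hy).resolve_left h0)]
    rw [key hy hi, key hy' hj]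
    cases e y <;> cases e y' <;> simp
  have hcol : ∀ {y}, Z y (b 2) → ∃ i, T i y ∧ i ≠ 2 := fun {y} hy => by
    rcases hp.1 hy with h1 | h1
    · exact ⟨0, h1, by decide⟩
    · exact ⟨1, h1, by decide⟩
  have hcolT : ∀ {y z}, Z y z → ∃ i, T i y := fun hy => by
    obtain ⟨i, j, -, h1, -⟩ := (h _ _).1 hy
    exact ⟨i, h1⟩
  have hcolS : ∀ {y z}, Z y z → ∃ i, S i z := fun hy => by
    obtain ⟨i, j, -, -, h1⟩ := (h _ _).1 hy
    exact ⟨j, h1⟩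
  refine pPInterprets_relOR_of_map (p := fun y => Z y (b 2)) (e := e) ?_ (hZ.right _) ?_ ?_
  · rintro (_ | _)
    · refine ⟨a 1, hp.2 (.inr (ha 1)), ?_⟩
      have : ¬ T 0 (a 1) := fun h0 => absurd (hT _ _ _ h0 (ha 1)) (by decide)
      simp [e, this]
    · exact ⟨a 0, hp.2 (.inl (ha 0)), by simp [e, ha 0]⟩
  · have : Γ.withParameters.PP2 fun x y => (Z x (b 2) ∧ Z y (b 2)) ∧
        ∃ z, Z x z ∧ Z y z ∧ Z (a 2) z := fun _ i j =>
      ((hZ.right _ i).and (hZ.right _ j)).and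
        (.ex ((hZ _ _).and ((hZ _ _).and (hZ.left _ _))))
    refine this.congr fun x y => and_congr_right fun ⟨hx, hy⟩ => ?_
    obtain ⟨i, hi, hi'⟩ := hcol hx
    obtain ⟨j, hj, hj'⟩ := hcol hy
    rw [he hx hy hi hj]
    have key : (∃ k, i ≠ k ∧ j ≠ k ∧ 2 ≠ k) ↔ i = j := ThreeColors.eq_iff hi' hj'
    rw [← key]
    constructor
    · rintro ⟨z, h1, h2, h3⟩
      obtain ⟨k, hk⟩ := hcolS h1
      exact ⟨k, (hZ' hi hk).1 h1, (hZ' hj hk).1 h2, (hZ' (ha 2) hk).1 h3⟩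
    · rintro ⟨k, h1, h2, h3⟩
      exact ⟨b k, (hZ' hi (hb k)).2 h1, (hZ' hj (hb k)).2 h2, (hZ' (ha 2) (hb k)).2 h3⟩
  · intro ι i j k l
    have : Γ.withParameters.PP fun x : ι → A =>
        (Z (x i) (b 2) ∧ Z (x j) (b 2) ∧ Z (x k) (b 2) ∧ Z (x l) (b 2)) ∧
        ∃ z v w' v' w, (Z (x i) z ∧ Z (x j) z ∧ Z v z ∧ Z v (b 0)) ∧
          (Z v w' ∧ Z (a 2) w' ∧ Z v' w' ∧ Z v' (b 1)) ∧ Z v' w ∧ Z (x k) w ∧ Z (x l) w :=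
      ((hZ.right _ i).and ((hZ.right _ j).and ((hZ.right _ k).and (hZ.right _ l)))).and
        (.ex (.ex (.ex (.ex (.ex
          (((hZ _ _).and ((hZ _ _).and ((hZ _ _).and (hZ.right _ _)))).and
            (((hZ _ _).and ((hZ.left _ _).and ((hZ _ _).and (hZ.right _ _)))).and
              ((hZ _ _).and ((hZ _ _).and (hZ _ _))))))))))
    refine this.congr fun x => and_congr_right fun ⟨h1, h2, h3, h4⟩ => ?_
    obtain ⟨i1, c1, d1⟩ := hcol h1
    obtain ⟨i2, c2, d2⟩ := hcol h2
    obtain ⟨i3, c3, d3⟩ := hcol h3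
    obtain ⟨i4, c4, d4⟩ := hcol h4
    rw [he h1 h2 c1 c2, he h3 h4 c3 c4]
    have key : (∃ z v w' v' w, (i1 ≠ z ∧ i2 ≠ z ∧ v ≠ z ∧ v ≠ 0) ∧
        (v ≠ w' ∧ 2 ≠ w' ∧ v' ≠ w' ∧ v' ≠ 1) ∧ v' ≠ w ∧ i3 ≠ w ∧ i4 ≠ w) ↔
        (i1 = i2 ∨ i3 = i4) := ThreeColors.or_iff d1 d2 d3 d4
    rw [← key]
    constructor
    · rintro ⟨z, v, w', v', w, ⟨g1, g2, g3, g4⟩, ⟨g5, g6, g7, g8⟩, g9, g10, g11⟩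
      obtain ⟨jz, hz⟩ := hcolS g1
      obtain ⟨jv, hv⟩ := hcolT g3
      obtain ⟨jw', hw'⟩ := hcolS g5
      obtain ⟨jv', hv'⟩ := hcolT g7
      obtain ⟨jw, hw⟩ := hcolS g9
      exact ⟨jz, jv, jw', jv', jw,
        ⟨(hZ' c1 hz).1 g1, (hZ' c2 hz).1 g2, (hZ' hv hz).1 g3, (hZ' hv (hb 0)).1 g4⟩,
        ⟨(hZ' hv hw').1 g5, (hZ' (ha 2) hw').1 g6, (hZ' hv' hw').1 g7, (hZ' hv' (hb 1)).1 g8⟩,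
        (hZ' hv' hw).1 g9, (hZ' c3 hw).1 g10, (hZ' c4 hw).1 g11⟩
    · rintro ⟨z, v, w', v', w, ⟨g1, g2, g3, g4⟩, ⟨g5, g6, g7, g8⟩, g9, g10, g11⟩
      exact ⟨b z, a v, b w', a v', b w,
        ⟨(hZ' c1 (hb _)).2 g1, (hZ' c2 (hb _)).2 g2, (hZ' (ha _) (hb _)).2 g3,
          (hZ' (ha _) (hb 0)).2 g4⟩,
        ⟨(hZ' (ha _) (hb _)).2 g5, (hZ' (ha 2) (hb _)).2 g6, (hZ' (ha _) (hb _)).2 g7,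
          (hZ' (ha _) (hb 1)).2 g8⟩,
        (hZ' (ha _) (hb _)).2 g9, (hZ' c3 (hb _)).2 g10, (hZ' c4 (hb _)).2 g11⟩

/-- A pp-definable bipartite graph which is the blow-up of `K_{n,n}` minus a perfect matching,
for some `n ≥ 3`, allows to pp-interpret `OR(=, =)`. -/
theorem pPInterprets_relOR_of_coMatching {n : ℕ} (hn : 3 ≤ n) {Z : A → A → Prop}
    (hZ : Γ.withParameters.PP2 Z) {T S : Fin n → A → Prop} (hT : ∀ i j y, T i y → T j y → i = j)
    (hS : ∀ i j y, S i y → S j y → i = j) (hT0 : ∀ i, ∃ y, T i y) (hS0 : ∀ i, ∃ y, S i y)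
    (h : ∀ y z, Z y z ↔ ∃ i j, i ≠ j ∧ T i y ∧ S j z) :
    Γ.withParameters.PPInterprets 1
      ({⟨2 + 2, relOR (⊥ : Setoid Bool).toRel (⊥ : Setoid Bool).toRel⟩} : RelStr Bool) := by
  classical
  choose a ha using hT0
  choose b hb using hS0
  have hZ' : ∀ {i j y z}, T i y → S j z → (Z y z ↔ i ≠ j) := fun {i j y z} hi hj => by
    rw [h]
    refine ⟨?_, fun hij => ⟨i, j, hij, hi, hj⟩⟩
    rintro ⟨i', j', h1, h2, h3⟩
    rwa [hT _ _ _ hi h2, hS _ _ _ hj h3]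
  -- Adjacency to the parameters `b k` and `a k` with `3 ≤ k` excludes the index `k` on either side.
  have h3 : Γ.withParameters.PP2 fun y z => Z y z ∧
      ∀ k ∈ Finset.univ.filter fun k : Fin n => 3 ≤ k.1, Z y (b k) ∧ Z (a k) z := fun _ i j =>
    PP.forall_mem _ (hZ i j) fun k _ => (hZ.right _ i).and (hZ.left _ j)
  have hinj := Fin.castLE_injective hn
  refine pPInterprets_relOR_of_three h3 (T := fun i => T (Fin.castLE hn i))
    (S := fun i => S (Fin.castLE hn i)) (fun i j y h1 h2 => hinj (hT _ _ _ h1 h2))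
    (fun i j y h1 h2 => hinj (hS _ _ _ h1 h2)) (fun i => ⟨_, ha _⟩) (fun i => ⟨_, hb _⟩) fun y z => ?_
  constructor
  · rintro ⟨h1, h2⟩
    obtain ⟨i, j, hij, hi, hj⟩ := (h _ _).1 h1
    have hi3 : i.1 < 3 := by
      by_contra hc
      exact (hZ' hi (hb i)).1 (h2 i (by simpa using hc)).1 rfl
    have hj3 : j.1 < 3 := by
      by_contra hc
      exact (hZ' (ha j) hj).1 (h2 j (by simpa using hc)).2 rfl
    exact ⟨⟨i, hi3⟩, ⟨j, hj3⟩, fun hc => hij (by ext; simpa using hc), hi, hj⟩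
  · rintro ⟨i, j, hij, hi, hj⟩
    refine ⟨(hZ' hi hj).2 fun hc => hij (hinj hc), fun k hk => ?_⟩
    have hk : 3 ≤ k.1 := by simpa using hk
    refine ⟨(hZ' hi (hb k)).2 ?_, (hZ' (ha k) hj).2 ?_⟩
    · rintro rfl
      exact absurd i.2 (Nat.not_lt.2 hk)
    · rintro rfl
      exact absurd j.2 (Nat.not_lt.2 hk)

end RelStr

/-! ### Colouring a finite graph from a family of definable sets -/

namespace DefinableGraph

variable {I : Type u} {N : I → I → Prop} {𝒟 : Set (Set I)} {A B C V X J J' : Set I}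

/-- The set of neighbours of the elements of `X`. -/
def nbr (N : I → I → Prop) (X : Set I) : Set I := {j | ∃ i ∈ X, N i j}

/-- `χ` is a proper 2-colouring of `J`. -/
def Proper (N : I → I → Prop) (J : Set I) (χ : I → Bool) : Prop :=
  ∀ i ∈ J, ∀ j ∈ J, N i j → χ i ≠ χ j

/-- Every proper 2-colouring of `J` is constant on `V`. -/
def Rig (N : I → I → Prop) (V J : Set I) : Prop :=
  ∀ χ, Proper N J χ → ∀ x ∈ V, ∀ y ∈ V, χ x = χ y

/-- The closure properties of the family of definable sets of vertices. -/
structure Tame (N : I → I → Prop) (𝒟 : Set (Set I)) : Prop where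
  symm : ∀ {i j}, N i j → N j i
  irrefl : ∀ i, ¬ N i i
  singleton : ∀ i, {i} ∈ 𝒟
  inter : ∀ {X Y}, X ∈ 𝒟 → Y ∈ 𝒟 → X ∩ Y ∈ 𝒟
  nbr : ∀ {X}, X ∈ 𝒟 → nbr N X ∈ 𝒟
  -- A closed walk of orbits need not lift to a closed walk of vertices, but a backtracking one
  -- does. So `W` is only sandwiched: its elements start closed 4-walks, and it contains the starts
  -- of two degenerate shapes.
  walk : ∀ {L₀ L₁ L₂ L₃}, L₀ ∈ 𝒟 → L₁ ∈ 𝒟 → L₂ ∈ 𝒟 → L₃ ∈ 𝒟 → ∃ W ∈ 𝒟,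
    (∀ i ∈ W, i ∈ L₀ ∧ ∃ z₁ ∈ L₁, ∃ z₂ ∈ L₂, ∃ z₃ ∈ L₃, N i z₁ ∧ N z₁ z₂ ∧ N z₂ z₃ ∧ N z₃ i) ∧
    (∀ i j k, i ∈ L₀ → j ∈ L₁ → j ∈ L₃ → k ∈ L₂ → N i j → N j k → i ∈ W) ∧
    (∀ i j l, i ∈ L₀ → i ∈ L₂ → j ∈ L₁ → l ∈ L₃ → N i j → N i l → i ∈ W)
  dichotomy : ∀ {X}, X ∈ 𝒟 → X = Set.univ ∨ ∃ χ, Proper N X χ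
  triangle : ∃ a b c, N a b ∧ N a c ∧ N b c

theorem nbr_mono (h : A ⊆ B) : nbr N A ⊆ nbr N B := fun _ ⟨i, hi, hj⟩ => ⟨i, h hi, hj⟩

theorem Proper.mono {χ : I → Bool} (h : Proper N J' χ) (hJ : J ⊆ J') : Proper N J χ :=
  fun i hi j hj => h i (hJ hi) j (hJ hj)

theorem Rig.mono (h : Rig N V J) (hJ : J ⊆ J') : Rig N V J' := fun χ hχ => h χ (hχ.mono hJ)

/-- Inside `J`, all neighbours of a monochromatic set get the opposite colour. -/
theorem Rig.nbr (h : Rig N V J) (hV : V ⊆ J) (hX : X ⊆ J) (hXV : X ⊆ nbr N V) : Rig N X J := by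
  intro χ hχ x hx y hy
  obtain ⟨v, hv, hvx⟩ := hXV hx
  obtain ⟨w, hw, hwy⟩ := hXV hy
  have h1 := hχ v (hV hv) x (hX hx) hvx
  have h2 := hχ w (hV hw) y (hX hy) hwy
  have h3 := h χ hχ v hv w hw
  revert h1 h2 h3
  cases χ v <;> cases χ w <;> cases χ x <;> cases χ y <;> simp

/-! ### Rigid tripartite configurations -/

/-- A nonempty definable independent set. -/
structure Side (N : I → I → Prop) (𝒟 : Set (Set I)) (A : Set I) : Prop where
  mem : A ∈ 𝒟
  nonempty : A.Nonempty
  indep : ∀ x ∈ A, ∀ y ∈ A, ¬ N x y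

/-- Two sets that see each other, each one being rigid in the neighbourhood of the other one. -/
structure Pr (N : I → I → Prop) (A B : Set I) : Prop where
  sub : A ⊆ nbr N B
  sub' : B ⊆ nbr N A
  rig : Rig N A (nbr N B)
  rig' : Rig N B (nbr N A)

theorem Pr.symm (h : Pr N A B) : Pr N B A := ⟨h.sub', h.sub, h.rig', h.rig⟩

/-- A tripartite configuration. -/
structure Good (N : I → I → Prop) (𝒟 : Set (Set I)) (A B C : Set I) : Prop where
  a : Side N 𝒟 A
  b : Side N 𝒟 B
  c : Side N 𝒟 C
  ab : Pr N A B
  ac : Pr N A C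
  bc : Pr N B C

theorem Good.rotate (h : Good N 𝒟 A B C) : Good N 𝒟 B C A :=
  ⟨h.b, h.c, h.a, h.bc, h.ab.symm, h.ac.symm⟩

/-- A tripartite configuration that cannot be enlarged. -/
def MaxGood (N : I → I → Prop) (𝒟 : Set (Set I)) (A B C : Set I) : Prop :=
  Good N 𝒟 A B C ∧ ∀ A' B' C', Good N 𝒟 A' B' C' → A ⊆ A' → B ⊆ B' → C ⊆ C' →
    A' = A ∧ B' = B ∧ C' = C

theorem MaxGood.rotate (h : MaxGood N 𝒟 A B C) : MaxGood N 𝒟 B C A :=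
  ⟨h.1.rotate, fun B' C' A' h' hb hc ha =>
    let ⟨h1, h2, h3⟩ := h.2 A' B' C' h'.rotate.rotate ha hb hc
    ⟨h2, h3, h1⟩⟩

theorem Side.nbr_ne_univ (h : Side N 𝒟 A) : nbr N A ≠ Set.univ := by
  intro h'
  obtain ⟨x, hx⟩ := h.nonempty
  obtain ⟨y, hy, hyx⟩ : x ∈ nbr N A := h' ▸ Set.mem_univ x
  exact h.indep _ hy _ hx hyx

namespace Tame

theorem exists_proper (h : Tame N 𝒟) (hJ : J ∈ 𝒟) (hJ' : J ≠ Set.univ) : ∃ χ, Proper N J χ :=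
  (h.dichotomy hJ).resolve_left hJ'

theorem eq_univ_of_triangle (h : Tame N 𝒟) (hX : X ∈ 𝒟) {a b c : I} (ha : a ∈ X) (hb : b ∈ X)
    (hc : c ∈ X) (hab : N a b) (hac : N a c) (hbc : N b c) : X = Set.univ := by
  refine (h.dichotomy hX).resolve_right ?_
  rintro ⟨χ, hχ⟩
  have h1 := hχ a ha b hb hab
  have h2 := hχ a ha c hc hac
  have h3 := hχ b hb c hc hbc
  revert h1 h2 h3
  cases χ a <;> cases χ b <;> cases χ c <;> simp

/-- The second neighbourhood of `a` is definable and contains the triangle, so it is everything. -/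
theorem exists_common_of_triangle (h : Tame N 𝒟) {a b c : I} (hab : N a b) (hac : N a c)
    (hbc : N b c) (y : I) : ∃ t, N a t ∧ N t y := by
  have := h.eq_univ_of_triangle (h.nbr (h.nbr (h.singleton a)))
    (a := a) (b := b) (c := c) ⟨b, ⟨a, rfl, hab⟩, h.symm hab⟩ ⟨c, ⟨a, rfl, hac⟩, h.symm hbc⟩
    ⟨b, ⟨a, rfl, hab⟩, hbc⟩ hab hac hbc
  obtain ⟨t, ⟨_, rfl, h1⟩, h2⟩ : y ∈ DefinableGraph.nbr N (DefinableGraph.nbr N {a}) :=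
    this ▸ Set.mem_univ y
  exact ⟨t, h1, h2⟩

/-- Any two vertices have a common neighbour. -/
theorem exists_common (h : Tame N 𝒟) (x y : I) : ∃ t, N x t ∧ N t y := by
  obtain ⟨a, b, c, hab, hac, hbc⟩ := h.triangle
  -- The triangle is moved through `a, t, s` to `t, r, x`, so that it contains `x`.
  obtain ⟨t, hat, htx⟩ := h.exists_common_of_triangle hab hac hbc x
  obtain ⟨s, has, hst⟩ := h.exists_common_of_triangle hab hac hbc t
  obtain ⟨r, htr, hrx⟩ := h.exists_common_of_triangle (h.symm hat) (h.symm hst) has x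
  exact h.exists_common_of_triangle (h.symm htx) (h.symm hrx) htr y

theorem indep_of_rig (h : Tame N 𝒟) (hJ : J ∈ 𝒟) (hJ' : J ≠ Set.univ) (hX : X ⊆ J)
    (hr : Rig N X J) : ∀ x ∈ X, ∀ y ∈ X, ¬ N x y := by
  intro x hx y hy hxy
  obtain ⟨χ, hχ⟩ := h.exists_proper hJ hJ'
  exact hχ x (hX hx) y (hX hy) hxy (hr χ hχ x hx y hy)

/-- Since `B` is rigid in `nbr N A` and `A` in `nbr N B`, the common neighbours of both sides are
rigid in either neighbourhood. Enlarging `C` enlarges its neighbourhood, which preserves the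
rigidity of `A` and `B` there. -/
theorem good_enlarge (h : Tame N 𝒟) (hg : Good N 𝒟 A B C) :
    C ⊆ DefinableGraph.nbr N A ∩ DefinableGraph.nbr N B ∧
      Good N 𝒟 A B (DefinableGraph.nbr N A ∩ DefinableGraph.nbr N B) := by
  have hC : C ⊆ DefinableGraph.nbr N A ∩ DefinableGraph.nbr N B :=
    fun x hx => ⟨hg.ac.sub' hx, hg.bc.sub' hx⟩
  have h1 : Rig N (DefinableGraph.nbr N A ∩ DefinableGraph.nbr N B) (DefinableGraph.nbr N A) :=
    hg.ab.rig'.nbr hg.ab.sub' Set.inter_subset_left Set.inter_subset_right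
  have h2 : Rig N (DefinableGraph.nbr N A ∩ DefinableGraph.nbr N B) (DefinableGraph.nbr N B) :=
    hg.ab.rig.nbr hg.ab.sub Set.inter_subset_right Set.inter_subset_left
  refine ⟨hC, hg.a, hg.b, ⟨h.inter (h.nbr hg.a.mem) (h.nbr hg.b.mem), hg.c.nonempty.mono hC,
    h.indep_of_rig (h.nbr hg.a.mem) hg.a.nbr_ne_univ Set.inter_subset_left h1⟩, hg.ab,
    ⟨hg.ac.sub.trans (nbr_mono hC), Set.inter_subset_left, hg.ac.rig.mono (nbr_mono hC), h1⟩,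
    ⟨hg.bc.sub.trans (nbr_mono hC), Set.inter_subset_right, hg.bc.rig.mono (nbr_mono hC), h2⟩⟩

theorem mem_of_maxGood (h : Tame N 𝒟) (hg : MaxGood N 𝒟 A B C) {x : I}
    (ha : x ∈ DefinableGraph.nbr N A) (hb : x ∈ DefinableGraph.nbr N B) : x ∈ C := by
  obtain ⟨hC, hg'⟩ := h.good_enlarge hg.1
  rw [← (hg.2 _ _ _ hg' subset_rfl subset_rfl hC).2.2]
  exact ⟨ha, hb⟩

theorem exists_maxGood [Finite I] (h : Tame N 𝒟) : ∃ A B C, MaxGood N 𝒟 A B C := by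
  obtain ⟨a, b, c, hab, hac, hbc⟩ := h.triangle
  have side : ∀ a, Side N 𝒟 {a} := fun a =>
    ⟨h.singleton a, Set.singleton_nonempty a, by rintro _ rfl _ rfl; exact h.irrefl _⟩
  have pr : ∀ {a b}, N a b → Pr N {a} {b} := fun {a b} hab => by
    refine ⟨?_, ?_, ?_, ?_⟩
    · rintro _ rfl
      exact ⟨b, rfl, h.symm hab⟩
    · rintro _ rfl
      exact ⟨a, rfl, hab⟩
    all_goals
      rintro χ - _ rfl _ rfl
      rfl
  have hg : Good N 𝒟 {a} {b} {c} := ⟨side a, side b, side c, pr hab, pr hac, pr hbc⟩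
  obtain ⟨⟨A, B, C⟩, hm⟩ := Set.Finite.exists_maximal
    (s := {t : Set I × Set I × Set I | Good N 𝒟 t.1 t.2.1 t.2.2}) (Set.toFinite _)
    ⟨({a}, {b}, {c}), hg⟩
  refine ⟨A, B, C, hm.1, fun A' B' C' h' ha hb hc => ?_⟩
  have := hm.eq_of_le (y := (A', B', C')) h' ⟨ha, hb, hc⟩
  simp only [Prod.mk.injEq] at this
  exact ⟨this.1.symm, this.2.1.symm, this.2.2.symm⟩

/-- A definable set `Y` which is closed under two steps inside the neighbourhood of `C` and which
contains `B`, and whose elements are all rigidly connected to `B`, enlarges the configuration. -/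
theorem subset_of_maxGood (h : Tame N 𝒟) (hg : MaxGood N 𝒟 A B C) {Y : Set I} (hY : Y ∈ 𝒟)
    (hYC : Y ⊆ DefinableGraph.nbr N C) (hBY : B ⊆ Y) (hu : DefinableGraph.nbr N Y ≠ Set.univ)
    (hr : Rig N Y (DefinableGraph.nbr N (DefinableGraph.nbr N
      (DefinableGraph.nbr N C ∩ DefinableGraph.nbr N Y) ∩ DefinableGraph.nbr N Y))) : Y ⊆ B := by
  have g := hg.1
  have symm := @Tame.symm _ _ _ h
  -- Starting from `C`, neighbourhoods are taken alternately within `nbr N Y`. The resulting sets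
  -- inherit rigidity in `nbr N Y` from `C`, and `A''`, `Y`, `C''` form a configuration above `A`,
  -- `B`, `C`.
  set A' := DefinableGraph.nbr N C ∩ DefinableGraph.nbr N Y with hA'
  set C'' := DefinableGraph.nbr N A' ∩ DefinableGraph.nbr N Y with hC''
  set A'' := DefinableGraph.nbr N C'' ∩ DefinableGraph.nbr N Y with hA''
  have mY := h.nbr hY
  have mA' : A' ∈ 𝒟 := h.inter (h.nbr g.c.mem) mY
  have mC'' : C'' ∈ 𝒟 := h.inter (h.nbr mA') mY
  have mA'' : A'' ∈ 𝒟 := h.inter (h.nbr mC'') mY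
  have sBY := nbr_mono (N := N) hBY
  have hAA' : A ⊆ A' := fun x hx => ⟨g.ac.sub hx, sBY (g.ab.sub hx)⟩
  have hCC'' : C ⊆ C'' := fun x hx => ⟨nbr_mono hAA' (g.ac.sub' hx), sBY (g.bc.sub' hx)⟩
  have hA'A'' : A' ⊆ A'' := fun x hx => ⟨nbr_mono hCC'' hx.1, hx.2⟩
  have hAA'' := hAA'.trans hA'A''
  have sC : C ⊆ DefinableGraph.nbr N Y := g.bc.sub'.trans sBY
  have rC : Rig N C (DefinableGraph.nbr N Y) := g.bc.rig'.mono sBY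
  have rA' : Rig N A' (DefinableGraph.nbr N Y) :=
    rC.nbr sC Set.inter_subset_right Set.inter_subset_left
  have rC'' : Rig N C'' (DefinableGraph.nbr N Y) :=
    rA'.nbr Set.inter_subset_right Set.inter_subset_right Set.inter_subset_left
  have rA'' : Rig N A'' (DefinableGraph.nbr N Y) :=
    rC''.nbr Set.inter_subset_right Set.inter_subset_right Set.inter_subset_left
  have hYA' : Y ⊆ DefinableGraph.nbr N A' := by
    intro y hy
    obtain ⟨c, hc, hcy⟩ := hYC hy
    obtain ⟨t, h1, h2⟩ := h.exists_common y c
    exact ⟨t, ⟨⟨c, hc, symm h2⟩, ⟨y, hy, h1⟩⟩, symm h1⟩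
  have hYA'' := hYA'.trans (nbr_mono hA'A'')
  have hYC'' := hYC.trans (nbr_mono hCC'')
  have rYA : Rig N Y (DefinableGraph.nbr N A'') :=
    (g.ac.rig'.mono (nbr_mono hAA'')).nbr (g.ac.sub'.trans (nbr_mono hAA'')) hYA'' hYC
  have sC''A'' : C'' ⊆ DefinableGraph.nbr N A'' :=
    Set.inter_subset_left.trans (nbr_mono hA'A'')
  have iY : ∀ x ∈ Y, ∀ y ∈ Y, ¬ N x y := by
    intro x hx y hy hxy
    obtain ⟨χ, hχ⟩ := h.exists_proper mY hu
    have hx' : x ∈ DefinableGraph.nbr N Y := ⟨y, hy, symm hxy⟩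
    have hy' : y ∈ DefinableGraph.nbr N Y := ⟨x, hx, hxy⟩
    obtain ⟨c, hc, hcx⟩ := hYC hx
    obtain ⟨d, hd, hdy⟩ := hYC hy
    have h1 := hχ c (sC hc) x hx' hcx
    have h2 := hχ d (sC hd) y hy' hdy
    have h3 := rC χ hχ c hc d hd
    have h4 := hχ x hx' y hy' hxy
    revert h1 h2 h3 h4
    cases χ c <;> cases χ d <;> cases χ x <;> cases χ y <;> simp
  have g' : Good N 𝒟 A'' Y C'' :=
    ⟨⟨mA'', g.a.nonempty.mono hAA'', h.indep_of_rig mY hu Set.inter_subset_right rA''⟩,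
      ⟨hY, g.b.nonempty.mono hBY, iY⟩,
      ⟨mC'', g.c.nonempty.mono hCC'', h.indep_of_rig mY hu Set.inter_subset_right rC''⟩,
      ⟨Set.inter_subset_right, hYA'', rA'', rYA⟩,
      ⟨Set.inter_subset_left, sC''A'', hr.nbr hYC'' Set.inter_subset_left Set.inter_subset_right,
        rYA.nbr hYA'' sC''A'' Set.inter_subset_right⟩,
      ⟨hYC'', Set.inter_subset_right, hr, rC''⟩⟩
  exact (hg.2 _ _ _ g' hAA'' hBY hCC'').2.1.subset

/-- The union of two sides of a maximal configuration is definable. -/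
theorem union_mem [Finite I] (h : Tame N 𝒟) (hg : MaxGood N 𝒟 A B C) : A ∪ B ∈ 𝒟 := by
  have g := hg.1
  have symm := @Tame.symm _ _ _ h
  set NB := DefinableGraph.nbr N B with hNB
  set NC := DefinableGraph.nbr N C with hNC
  have mB : NB ∈ 𝒟 := h.nbr g.b.mem
  have mC : NC ∈ 𝒟 := h.nbr g.c.mem
  have inA : ∀ {x}, x ∈ NB → x ∈ NC → x ∈ A := h.mem_of_maxGood hg.rotate
  have inB : ∀ {x}, x ∈ DefinableGraph.nbr N A → x ∈ NC → x ∈ B := fun h1 h2 =>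
    h.mem_of_maxGood hg.rotate.rotate h2 h1
  have inC : ∀ {x}, x ∈ DefinableGraph.nbr N A → x ∈ NB → x ∈ C := h.mem_of_maxGood hg
  -- Points of `A` and of `B` start the two degenerate shapes of closed walks through `NC`, `NC`,
  -- `NB`, `NB`. The work lies in showing that no other points start such walks.
  obtain ⟨W, hW, w1, w2, w3⟩ := h.walk mC mC mB mB
  suffices W = A ∪ B from this ▸ hW
  refine Set.Subset.antisymm ?_ (Set.union_subset ?_ ?_)
  swap
  · intro x hx
    obtain ⟨b, hb, hbx⟩ := g.ab.sub hx
    obtain ⟨c, hc, hcx⟩ := g.ac.sub hx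
    exact w3 x b c (g.ac.sub hx) (g.ab.sub hx) (g.bc.sub hb) (g.bc.sub' hc) (symm hbx) (symm hcx)
  swap
  · intro x hx
    obtain ⟨a, ha, hax⟩ := g.ab.sub' hx
    obtain ⟨c, hc, hca⟩ := g.ac.sub ha
    exact w2 x a c (g.bc.sub hx) (g.ac.sub ha) (g.ab.sub ha) (g.bc.sub' hc) (symm hax) (symm hca)
  intro p hp
  obtain ⟨hpC, z1, hz1, z2, hz2, z3, hz3, p1, p2, p3, p4⟩ := w1 p hp
  -- `X` collects the ends of all walks from `p` through the same sets. It contains `p` because the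
  -- given walk is closed, and it meets `B` because `z3` has a neighbour there.
  set X1 := DefinableGraph.nbr N {p} ∩ NC with hX1
  set X2 := DefinableGraph.nbr N X1 ∩ NB with hX2
  set X3 := DefinableGraph.nbr N X2 ∩ NB with hX3
  set X := DefinableGraph.nbr N X3 ∩ NC with hX
  have mX : X ∈ 𝒟 :=
    h.inter (h.nbr (h.inter (h.nbr (h.inter (h.nbr (h.inter (h.nbr (h.singleton p)) mC)) mB)) mB)) mC
  have hz3X : z3 ∈ X3 := ⟨⟨z2, ⟨⟨z1, ⟨⟨p, rfl, p1⟩, hz1⟩, p2⟩, hz2⟩, p3⟩, hz3⟩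
  have hpX : p ∈ X := ⟨⟨z3, hz3X, p4⟩, hpC⟩
  obtain ⟨b, hb, hb3⟩ := hz3
  have hbX : b ∈ X := ⟨⟨z3, hz3X, symm hb3⟩, g.bc.sub hb⟩
  by_cases hXA : ∃ q ∈ X, q ∈ A
  -- Read backwards from an end in `A`, maximality places the vertices of the walk in `C`, `A`, `B`
  -- and finally `p` in `A`.
  · left
    obtain ⟨q, ⟨⟨y3, ⟨⟨y2, ⟨⟨y1, ⟨⟨_, rfl, q1⟩, hy1⟩, q2⟩, hy2⟩, q3⟩, hy3⟩, q4⟩, hq⟩, hqA⟩ := hXA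
    have k3 := inC ⟨q, hqA, symm q4⟩ hy3
    have k2 := inA hy2 ⟨y3, k3, symm q3⟩
    have k1 := inB ⟨y2, k2, symm q2⟩ hy1
    exact inA ⟨y1, k1, symm q1⟩ hpC
  right
  -- Otherwise `X` is saturated under two steps inside `NC`. This neither reaches `A` nor produces
  -- colours absent from `X`, and maximality encodes the saturation.
  obtain ⟨Y, ⟨mY, hXY, hYC, hYA, hYl⟩, hYm⟩ := Set.Finite.exists_maximal
    (s := {Z : Set I | Z ∈ 𝒟 ∧ X ⊆ Z ∧ Z ⊆ NC ∧ (∀ z ∈ Z, z ∉ A) ∧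
      ∀ χ, Proper N NC χ → ∀ z ∈ Z, ∃ x ∈ X, χ z = χ x}) (Set.toFinite _)
    ⟨X, mX, subset_rfl, Set.inter_subset_right, fun q hq hqA => hXA ⟨q, hq, hqA⟩,
      fun χ _ z hz => ⟨z, hz, rfl⟩⟩
  have hcl : ∀ {y t z}, z ∈ Y → t ∈ NC → y ∈ NC → N z t → N t y → y ∈ Y := by
    intro y t z hz ht hy hzt hty
    have hsub : Y ⊆ DefinableGraph.nbr N (DefinableGraph.nbr N Y ∩ NC) ∩ NC := by
      intro w hw
      obtain ⟨c, hc, hcw⟩ := hYC hw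
      obtain ⟨s, h1, h2⟩ := h.exists_common w c
      exact ⟨⟨s, ⟨⟨w, hw, h1⟩, ⟨c, hc, symm h2⟩⟩, symm h1⟩, hYC hw⟩
    refine hYm (y := DefinableGraph.nbr N (DefinableGraph.nbr N Y ∩ NC) ∩ NC)
      ⟨h.inter (h.nbr (h.inter (h.nbr mY) mC)) mC, hXY.trans hsub, Set.inter_subset_right, ?_, ?_⟩
      hsub ⟨⟨t, ⟨⟨z, hz, hzt⟩, ht⟩, hty⟩, hy⟩
    · rintro a ⟨⟨s, ⟨⟨w, hw, hws⟩, hs⟩, hsa⟩, ha⟩ haA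
      exact hYA w hw (inA ⟨s, inB ⟨a, haA, symm hsa⟩ hs, symm hws⟩ (hYC hw))
    · rintro χ hχ x ⟨⟨s, ⟨⟨w, hw, hws⟩, hs⟩, hsx⟩, hx⟩
      obtain ⟨x', hx', he⟩ := hYl χ hχ w hw
      refine ⟨x', hx', he ▸ ?_⟩
      have h1 := hχ w (hYC hw) s hs hws
      have h2 := hχ s hs x hx hsx
      revert h1 h2
      cases χ w <;> cases χ s <;> cases χ x <;> simp
  have hBY' : ∀ x ∈ B, x ∉ DefinableGraph.nbr N Y := by
    rintro x hx ⟨y, hy, hyx⟩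
    obtain ⟨a, ha, hax⟩ := g.ab.sub' hx
    exact hYA a (hcl hy (g.bc.sub hx) (g.ac.sub ha) hyx (symm hax)) ha
  -- `M` is a union of components of `NC`. Flipping a colouring on `M` would separate `b` from a
  -- point of `B` outside `Y`, against the rigidity of `B`.
  have hBY : B ⊆ Y := by
    classical
    intro x hx
    obtain ⟨χ, hχ⟩ := h.exists_proper mC g.c.nbr_ne_univ
    let M := Y ∪ (NC ∩ DefinableGraph.nbr N Y)
    have hM : ∀ {i j}, i ∈ NC → j ∈ NC → N i j → i ∈ M → j ∈ M := by
      rintro i j hi hj hij (h1 | ⟨h1, y, hy, hyi⟩)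
      · exact .inr ⟨hj, i, h1, hij⟩
      · exact .inl (hcl hy hi hj hyi hij)
    have hχ' : Proper N NC fun i => if i ∈ M then !χ i else χ i := by
      intro i hi j hj hij
      have h1 := hχ i hi j hj hij
      have h2 : i ∈ M ↔ j ∈ M := ⟨hM hi hj hij, hM hj hi (symm hij)⟩
      by_cases h3 : j ∈ M
      · simpa [h2.2 h3, h3] using h1
      · simpa [h3, mt h2.1 h3] using h1
    have h1 := g.bc.rig χ hχ b hb x hx
    have h2 := g.bc.rig _ hχ' b hb x hx
    have h3 : b ∈ M := .inl (hXY hbX)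
    by_contra hxY
    have h4 : x ∉ M := by
      rintro (h4 | h4)
      · exact hxY h4
      · exact hBY' x hx h4.2
    simp only [h3, h4, if_true, if_false, h1] at h2
    revert h2
    cases χ x <;> simp
  have hu : DefinableGraph.nbr N Y ≠ Set.univ := fun hu => hBY' b hb (hu ▸ Set.mem_univ b)
  refine h.subset_of_maxGood hg mY hYC hBY hu ?_ (hXY hpX)
  set A' := NC ∩ DefinableGraph.nbr N Y with hA'
  set C'' := DefinableGraph.nbr N A' ∩ DefinableGraph.nbr N Y with hC''
  have hCC'' : C ⊆ C'' := fun x hx =>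
    ⟨nbr_mono (A := A) (B := A') (fun x hx => ⟨g.ac.sub hx, nbr_mono hBY (g.ab.sub hx)⟩) (g.ac.sub' hx),
      nbr_mono hBY (g.bc.sub' hx)⟩
  have hNC : NC ⊆ DefinableGraph.nbr N C'' := nbr_mono hCC''
  intro χ hχ
  -- Each point of `X` shares the neighbour `y3` with some point of `B`, and `y3` lies in `nbr N
  -- C''`, where `χ` is proper.
  have hX' : ∀ x ∈ X, χ x = χ b := by
    rintro q ⟨⟨y3, ⟨⟨y2, ⟨⟨y1, ⟨⟨_, rfl, q1⟩, hy1⟩, q2⟩, hy2⟩, q3⟩, ⟨b', hb', hb3'⟩⟩, q4⟩, hq⟩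
    have k1 : y1 ∈ A' := ⟨hy1, _, hXY hpX, q1⟩
    have k2 : y2 ∈ C'' := ⟨⟨y1, k1, q2⟩, nbr_mono hBY hy2⟩
    have k3 : y3 ∈ DefinableGraph.nbr N C'' := ⟨y2, k2, q3⟩
    have h1 := hχ y3 k3 q (hNC hq) q4
    have h2 := hχ b' (hNC (g.bc.sub hb')) y3 k3 hb3'
    rw [← g.bc.rig χ (hχ.mono hNC) b' hb' b hb]
    revert h1 h2
    cases χ y3 <;> cases χ q <;> cases χ b' <;> simp
  have hY' : ∀ x ∈ Y, χ x = χ b := fun x hx => by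
    obtain ⟨x', hx', he⟩ := hYl χ (hχ.mono hNC) x hx
    rw [he, hX' x' hx']
  intro x hx y hy
  rw [hY' x hx, hY' y hy]

/-- A graph with definable sets is three-colourable by definable sets whose pairwise unions are
definable, too, and each vertex sees the two other colours. -/
theorem exists_threeColoring [Finite I] (h : Tame N 𝒟) : ∃ V : Fin 3 → Set I,
    (∀ u v, V u ∪ V v ∈ 𝒟) ∧ (∀ u, (V u).Nonempty) ∧
    (∀ x, ∃ u, x ∈ V u) ∧ (∀ u v x, x ∈ V u → x ∈ V v → u = v) ∧
    (∀ u x y, x ∈ V u → y ∈ V u → ¬ N x y) ∧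
    ∀ u v, u ≠ v → ∀ x ∈ V u, ∃ y ∈ V v, N x y := by
  obtain ⟨A, B, C, hg⟩ := h.exists_maxGood
  -- The neighbourhood of the definable set `A ∪ B` contains a triangle, so it is everything.
  -- Applied to all three pairs, every vertex sees two sides, and by maximality it lies in the
  -- remaining one.
  have key : ∀ {A B C}, MaxGood N 𝒟 A B C → ∀ x,
      x ∈ DefinableGraph.nbr N A ∨ x ∈ DefinableGraph.nbr N B := by
    intro A B C hg x
    obtain ⟨a, ha⟩ := hg.1.a.nonempty
    obtain ⟨b, hb, hba⟩ := hg.1.ab.sub ha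
    obtain ⟨t, h1, h2⟩ := h.exists_common a b
    have := h.eq_univ_of_triangle (h.nbr (h.union_mem hg)) (a := a) (b := b) (c := t)
      ⟨b, .inr hb, hba⟩ ⟨a, .inl ha, h.symm hba⟩ ⟨a, .inl ha, h1⟩ (h.symm hba) h1 (h.symm h2)
    obtain ⟨y, hy | hy, hyx⟩ : x ∈ DefinableGraph.nbr N (A ∪ B) := this ▸ Set.mem_univ x
    · exact .inl ⟨y, hy, hyx⟩
    · exact .inr ⟨y, hy, hyx⟩
  have nbr_sub : ∀ {A B C}, MaxGood N 𝒟 A B C →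
      (∀ x ∈ A, ∃ y ∈ B, N x y) ∧ (∀ x ∈ B, ∃ y ∈ A, N x y) := by
    intro A B C hg
    constructor
    · intro x hx
      obtain ⟨y, hy, hyx⟩ := hg.1.ab.sub hx
      exact ⟨y, hy, h.symm hyx⟩
    · intro x hx
      obtain ⟨y, hy, hyx⟩ := hg.1.ab.sub' hx
      exact ⟨y, hy, h.symm hyx⟩
  have i1 := hg.1.a.indep
  have i2 := hg.1.b.indep
  have i3 := hg.1.c.indep
  have n1 := nbr_sub hg
  have n2 := nbr_sub hg.rotate
  have n3 := nbr_sub hg.rotate.rotate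
  have u1 := h.union_mem hg
  have u2 := h.union_mem hg.rotate
  have u3 := h.union_mem hg.rotate.rotate
  have hind : ∀ u : Fin 3, ∀ x ∈ ![A, B, C] u, ∀ y ∈ ![A, B, C] u, ¬ N x y := by
    intro u
    fin_cases u
    exacts [i1, i2, i3]
  have hsee : ∀ u v : Fin 3, u ≠ v → ∀ x ∈ ![A, B, C] u, ∃ y ∈ ![A, B, C] v, N x y := by
    intro u v huv
    fin_cases u <;> fin_cases v
    exacts [(huv rfl).elim, n1.1, n3.2, n1.2, (huv rfl).elim, n2.1, n3.1, n2.2, (huv rfl).elim]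
  refine ⟨![A, B, C], ?_, ?_, ?_, ?_, fun u x y hx hy => hind u x hx y hy, hsee⟩
  · intro u v
    have v1 : A ∪ A ∈ 𝒟 := (Set.union_self A).symm ▸ hg.1.a.mem
    have v2 : B ∪ B ∈ 𝒟 := (Set.union_self B).symm ▸ hg.1.b.mem
    have v3 : C ∪ C ∈ 𝒟 := (Set.union_self C).symm ▸ hg.1.c.mem
    have w1 := Set.union_comm A B ▸ u1
    have w2 := Set.union_comm B C ▸ u2
    have w3 := Set.union_comm C A ▸ u3
    fin_cases u <;> fin_cases v
    exacts [v1, u1, w3, w1, v2, u2, u3, w2, v3]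
  · intro u
    fin_cases u
    exacts [hg.1.a.nonempty, hg.1.b.nonempty, hg.1.c.nonempty]
  · intro x
    rcases key hg x with h1 | h1
    · rcases key hg.rotate x with h2 | h2
      · exact ⟨2, h.mem_of_maxGood hg h1 h2⟩
      · exact ⟨1, h.mem_of_maxGood hg.rotate.rotate h2 h1⟩
    · rcases key hg.rotate.rotate x with h2 | h2
      · exact ⟨0, h.mem_of_maxGood hg.rotate h1 h2⟩
      · exact ⟨2, h.mem_of_maxGood hg h2 h1⟩
  · intro u v x hu hv
    by_contra huv
    obtain ⟨y, hy, hxy⟩ := hsee v u (Ne.symm huv) x hv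
    exact hind u x hu y hy hxy

end Tame

end DefinableGraph

/-! ### Invariant relations -/

section Invariant

variable {A : Type u} (G : Type v) [Group G] [MulAction G A]

/-- A binary relation is invariant under a group action. -/
def Inv2 (r : A → A → Prop) : Prop := ∀ (g : G) x y, r x y → r (g • x) (g • y)

variable {G} {r s : A → A → Prop}

theorem Inv2.flip (hr : Inv2 G r) : Inv2 G fun x y => r y x := fun g x y => hr g y x

theorem Inv2.comp (hr : Inv2 G r) (hs : Inv2 G s) : Inv2 G (Relation.Comp r s) :=
  fun g _ _ ⟨z, h1, h2⟩ => ⟨g • z, hr g _ _ h1, hs g _ _ h2⟩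

end Invariant

/-! ### Tripartite relations -/

namespace Tripartite

open RelStr

variable {A : Type u} {G : Type v} [Group G] [MulAction G A] {Γ : RelStr A} {S : A → Prop}
  {col : A → Fin 3} {Q : A → A → Prop} {x y y' z : A} {i j l : Fin 3}

/-- The union of two of the three colour classes. -/
def Two (S : A → Prop) (col : A → Fin 3) (u v : Fin 3) (x : A) : Prop :=
  S x ∧ (col x = u ∨ col x = v)

/-- An invariant set `S` with an invariant map to three colours such that any union of at most two
colour classes is pp-definable. -/
structure Coloring (G : Type v) [Group G] [MulAction G A] (Γ : RelStr A) (S : A → Prop)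
    (col : A → Fin 3) : Prop where
  pp : ∀ u v, Γ.PP1 (Two S col u v)
  inv : ∀ (g : G) x, S x → S (g • x)
  inv_col : ∀ (g : G) x, S x → col (g • x) = col x

/-- A pp-definable invariant relation between vertices of different colours such that
each vertex has neighbours of both other colours on both sides. -/
structure Rel (G : Type v) [Group G] [MulAction G A] (Γ : RelStr A) (S : A → Prop)
    (col : A → Fin 3) (Q : A → A → Prop) : Prop where
  pp : Γ.PP2 Q
  inv : Inv2 G Q
  left : ∀ {x y}, Q x y → S x
  right : ∀ {x y}, Q x y → S y
  ne : ∀ {x y}, Q x y → col x ≠ col y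
  out : ∀ x v, S x → col x ≠ v → ∃ y, Q x y ∧ col y = v
  inn : ∀ x v, S x → col x ≠ v → ∃ y, Q y x ∧ col y = v

theorem Rel.flip (h : Rel G Γ S col Q) : Rel G Γ S col fun x y => Q y x :=
  ⟨h.pp.flip, h.inv.flip, h.right, h.left, fun hxy => (h.ne hxy).symm, h.inn, h.out⟩

/-- No larger tripartite relation exists. -/
def MaxRel (G : Type v) [Group G] [MulAction G A] (Γ : RelStr A) (S : A → Prop)
    (col : A → Fin 3) (Q : A → A → Prop) : Prop :=
  Rel G Γ S col Q ∧ ∀ Q', Rel G Γ S col Q' → (∀ x y, Q x y → Q' x y) → ∀ x y, Q' x y → Q x y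

theorem MaxRel.flip (h : MaxRel G Γ S col Q) : MaxRel G Γ S col fun x y => Q y x :=
  ⟨h.1.flip, fun _ h' hle x y hxy => h.2 _ h'.flip (fun x y hxy => hle y x hxy) y x hxy⟩

theorem exists_maxRel (hfin : {r : A → A → Prop | Inv2 G r}.Finite) (h : Rel G Γ S col Q) :
    ∃ Q', MaxRel G Γ S col Q' := by
  obtain ⟨Q', hQ'⟩ := Set.Finite.exists_maximal (s := {r | Rel G Γ S col r})
    (hfin.subset fun r hr => hr.inv) ⟨Q, h⟩
  exact ⟨Q', hQ'.1, fun Q'' h'' hle => hQ'.2 h'' hle⟩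

/-- A relation that sends colour `l` to colour `l`. -/
def Back (S : A → Prop) (col : A → Fin 3) (Q : A → A → Prop) (i j l : Fin 3) (x y : A) : Prop :=
  ∃ u₁ u₂ u₃, (Q u₁ x ∧ Q u₁ u₂ ∧ Q u₃ u₂ ∧ Q u₃ y) ∧
    (Two S col j l x ∧ Two S col j l u₁ ∧ Two S col j l y) ∧ Two S col i j u₂ ∧ Two S col i j u₃

/-- A reflexive relation that preserves colours. -/
def Psi (S : A → Prop) (col : A → Fin 3) (Q : A → A → Prop) (i j l : Fin 3) (y y' : A) : Prop :=
  (∃ x, (Q y x ∧ Q y' x) ∧ Two S col i l x) ∧ (∃ x, (Q y x ∧ Q y' x) ∧ Two S col i j x) ∧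
    ∃ u u', (Q y u ∧ Q y' u') ∧ (Two S col j l u ∧ Two S col j l u') ∧
      Back S col Q i j l u u' ∧ Back S col Q i j l u' u

theorem Coloring.pp_back (hS : Coloring G Γ S col) (h : Rel G Γ S col Q) (i j l : Fin 3) :
    Γ.PP2 (Back S col Q i j l) := fun _ _ _ =>
  .ex (.ex (.ex (((h.pp _ _).and ((h.pp _ _).and ((h.pp _ _).and (h.pp _ _)))).and
    (((hS.pp j l _).and ((hS.pp j l _).and (hS.pp j l _))).and
      ((hS.pp i j _).and (hS.pp i j _))))))

theorem Coloring.pp_psi (hS : Coloring G Γ S col) (h : Rel G Γ S col Q) (i j l : Fin 3) :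
    Γ.PP2 (Psi S col Q i j l) := fun _ _ _ =>
  .and (.ex (((h.pp _ _).and (h.pp _ _)).and (hS.pp i l _)))
    (.and (.ex (((h.pp _ _).and (h.pp _ _)).and (hS.pp i j _)))
      (.ex (.ex (((h.pp _ _).and (h.pp _ _)).and (((hS.pp j l _).and (hS.pp j l _)).and
        ((hS.pp_back h i j l _ _).and (hS.pp_back h i j l _ _)))))))

theorem Coloring.inv_two (hS : Coloring G Γ S col) (g : G) {u v : Fin 3} (h : Two S col u v x) :
    Two S col u v (g • x) :=
  ⟨hS.inv g x h.1, (hS.inv_col g x h.1).symm ▸ h.2⟩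

theorem Coloring.inv_back (hS : Coloring G Γ S col) (h : Rel G Γ S col Q) (i j l : Fin 3) :
    Inv2 G (Back S col Q i j l) := by
  rintro g x y ⟨u1, u2, u3, ⟨h1, h2, h3, h4⟩, ⟨h5, h6, h7⟩, h8, h9⟩
  exact ⟨g • u1, g • u2, g • u3, ⟨h.inv g _ _ h1, h.inv g _ _ h2, h.inv g _ _ h3, h.inv g _ _ h4⟩,
    ⟨hS.inv_two g h5, hS.inv_two g h6, hS.inv_two g h7⟩, hS.inv_two g h8, hS.inv_two g h9⟩

theorem Coloring.inv_psi (hS : Coloring G Γ S col) (h : Rel G Γ S col Q) (i j l : Fin 3) :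
    Inv2 G (Psi S col Q i j l) := by
  rintro g x y ⟨⟨a, ⟨a1, a2⟩, a3⟩, ⟨b, ⟨b1, b2⟩, b3⟩, u, u', ⟨h1, h2⟩, ⟨h3, h4⟩, h5, h6⟩
  exact ⟨⟨g • a, ⟨h.inv g _ _ a1, h.inv g _ _ a2⟩, hS.inv_two g a3⟩,
    ⟨g • b, ⟨h.inv g _ _ b1, h.inv g _ _ b2⟩, hS.inv_two g b3⟩, g • u, g • u',
    ⟨h.inv g _ _ h1, h.inv g _ _ h2⟩, ⟨hS.inv_two g h3, hS.inv_two g h4⟩,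
    hS.inv_back h i j l g _ _ h5, hS.inv_back h i j l g _ _ h6⟩

theorem eq_or_of_distinct (hij : i ≠ j) (hil : i ≠ l) (hjl : j ≠ l) (a : Fin 3) :
    a = i ∨ a = j ∨ a = l := by
  revert i j l a
  decide

/-- From colour `l` each constraint leaves a single choice: `u₁` has colour `j`, `u₂` has `i`, `u₃`
has `j`, and `y` has `l`. -/
theorem Rel.back_col (h : Rel G Γ S col Q) (hij : i ≠ j) (hil : i ≠ l) (hjl : j ≠ l)
    (hb : Back S col Q i j l x y) (hx : col x = l) : col y = l := by
  obtain ⟨u1, u2, u3, ⟨h1, h2, h3, h4⟩, ⟨h5, h6, h7⟩, h8, h9⟩ := hb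
  have h1 := h.ne h1
  have h2 := h.ne h2
  have h3 := h.ne h3
  have h4 := h.ne h4
  have h6 := h6.2
  have h7 := h7.2
  have h8 := h8.2
  have h9 := h9.2
  generalize col x = cx at *
  generalize col y = cy at *
  generalize col u1 = c1 at *
  generalize col u2 = c2 at *
  generalize col u3 = c3 at *
  subst hx
  obtain rfl := h6.resolve_right h1
  obtain rfl := h8.resolve_right (Ne.symm h2)
  obtain rfl := h9.resolve_left h3
  exact h7.resolve_left (Ne.symm h4)

/-- If the colours differed, both common out-neighbours would have the third colour, necessarily
`i`, so the two vertices would be coloured `j` and `l`. The one coloured `j` has its out-neighbour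
`u` or `u'` coloured `l`; `Back` forces colour `l` on the other, which is impossible next to a
vertex of colour `l`. -/
theorem Rel.psi_col (h : Rel G Γ S col Q) (hij : i ≠ j) (hil : i ≠ l) (hjl : j ≠ l)
    (hp : Psi S col Q i j l x y) : col x = col y := by
  obtain ⟨⟨a, ⟨a1, a2⟩, -, a3⟩, ⟨b, ⟨b1, b2⟩, -, b3⟩, u, u', ⟨h1, h2⟩, ⟨⟨-, h3⟩, -, h4⟩, h5, h6⟩ := hp
  have a1 := h.ne a1
  have a2 := h.ne a2
  have b1 := h.ne b1
  have b2 := h.ne b2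
  have h1 := h.ne h1
  have h2 := h.ne h2
  have h5 := h.back_col hij hil hjl h5
  have h6 := h.back_col hij hil hjl h6
  have c1 := eq_or_of_distinct hij hil hjl (col x)
  have c2 := eq_or_of_distinct hij hil hjl (col y)
  grind

theorem Rel.psi_refl (h : Rel G Γ S col Q) (hij : i ≠ j) (hil : i ≠ l) (hjl : j ≠ l)
    (hx : S x) : Psi S col Q i j l x x := by
  have two : ∀ {a b}, a ≠ b → ∃ y, (Q x y ∧ Q x y) ∧ Two S col a b y := by
    intro a b hab
    by_cases hxa : col x = a
    · obtain ⟨y, h1, h2⟩ := h.out x b hx (hxa ▸ hab)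
      exact ⟨y, ⟨h1, h1⟩, h.right h1, .inr h2⟩
    · obtain ⟨y, h1, h2⟩ := h.out x a hx hxa
      exact ⟨y, ⟨h1, h1⟩, h.right h1, .inl h2⟩
  refine ⟨two hil, two hij, ?_⟩
  obtain ⟨u, hu, hu', hcu⟩ := two hjl
  have hb : Back S col Q i j l u u := by
    rcases hcu with hcu | hcu
    · obtain ⟨u1, h1, c1⟩ := h.inn u l hu' (hcu ▸ hjl)
      obtain ⟨u3, h3, c3⟩ := h.inn u i hu' (hcu ▸ hij.symm)
      exact ⟨u1, u, u3, ⟨h1, h1, h3, h3⟩, ⟨⟨hu', .inl hcu⟩, ⟨h.left h1, .inr c1⟩, ⟨hu', .inl hcu⟩⟩,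
        ⟨hu', .inr hcu⟩, h.left h3, .inl c3⟩
    · obtain ⟨u1, h1, c1⟩ := h.inn u j hu' (hcu ▸ hjl.symm)
      obtain ⟨u2, h2, c2⟩ := h.out u1 i (h.left h1) (c1 ▸ hij.symm)
      exact ⟨u1, u2, u1, ⟨h1, h2, h2, h1⟩,
        ⟨⟨hu', .inr hcu⟩, ⟨h.left h1, .inl c1⟩, ⟨hu', .inr hcu⟩⟩,
        ⟨h.right h2, .inl c2⟩, h.left h1, .inr c1⟩
  exact ⟨u, u, hu, ⟨⟨hu', hcu⟩, hu', hcu⟩, hb, hb⟩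

/-- The vertex `x` serves both common-neighbour clauses, and `y, x, y'` (or its reverse) is the
middle of each `Back` walk. -/
theorem Rel.psi_of_common (h : Rel G Γ S col Q) (hjl : j ≠ l)
    (hy : col y = j) (hy' : col y' = j) (hx : col x = i) (h1 : Q y x) (h2 : Q y' x) :
    Psi S col Q i j l y y' := by
  have sx := h.right h1
  have sy := h.left h1
  have sy' := h.left h2
  obtain ⟨u, h3, c3⟩ := h.out y l sy (hy ▸ hjl)
  obtain ⟨u', h4, c4⟩ := h.out y' l sy' (hy' ▸ hjl)
  have tu : Two S col j l u := ⟨h.right h3, .inr c3⟩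
  have tu' : Two S col j l u' := ⟨h.right h4, .inr c4⟩
  exact ⟨⟨x, ⟨h1, h2⟩, sx, .inl hx⟩, ⟨x, ⟨h1, h2⟩, sx, .inl hx⟩, u, u', ⟨h3, h4⟩, ⟨tu, tu'⟩,
    ⟨y, x, y', ⟨h3, h1, h2, h4⟩, ⟨tu, ⟨sy, .inl hy⟩, tu'⟩, ⟨sx, .inl hx⟩, sy', .inr hy'⟩,
    ⟨y', x, y, ⟨h4, h2, h1, h3⟩, ⟨tu', ⟨sy', .inl hy'⟩, tu⟩, ⟨sx, .inl hx⟩, sy, .inr hy⟩⟩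

/-- In a maximal tripartite relation, two vertices of the same colour with a common
out-neighbour have the same out-neighbours. -/
theorem MaxRel.out_of_common (hS : Coloring G Γ S col) (hm : MaxRel G Γ S col Q)
    (hc : col y = col y') (h1 : Q y x) (h2 : Q y' x) (h3 : Q y' z) : Q y z := by
  have h := hm.1
  obtain ⟨l, hil, hjl⟩ : ∃ l, col x ≠ l ∧ col y ≠ l := by
    generalize col x = a
    generalize col y = b
    revert a b
    decide
  have hij := (h.ne h1).symm
  have hcol : ∀ {a b}, Psi S col Q (col x) (col y) l a b → col a = col b :=
    fun hp => h.psi_col hij hil hjl hp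
  have hle : ∀ a b, Q a b → Relation.Comp (Psi S col Q (col x) (col y) l) Q a b :=
    fun a b hab => ⟨a, h.psi_refl hij hil hjl (h.left hab), hab⟩
  -- Prefixing the reflexive, colour-preserving `Psi` yields a tripartite relation above `Q`, hence
  -- `Q` itself; and `Psi` relates `y` to `y'`.
  refine hm.2 (Relation.Comp (Psi S col Q (col x) (col y) l) Q)
    ⟨(hS.pp_psi h _ _ _).comp h.pp, (hS.inv_psi h _ _ _).comp h.inv, ?_, ?_, ?_, ?_, ?_⟩ hle y z
    ⟨y', h.psi_of_common hjl rfl hc.symm rfl h1 h2, h3⟩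
  · rintro a b ⟨w, ⟨⟨_, ⟨h1, _⟩, _⟩, _⟩, _⟩
    exact h.left h1
  · rintro a b ⟨w, _, h1⟩
    exact h.right h1
  · rintro a b ⟨w, h1, h2⟩
    exact hcol h1 ▸ h.ne h2
  · intro a v ha hav
    obtain ⟨b, hb, hb'⟩ := h.out a v ha hav
    exact ⟨b, hle _ _ hb, hb'⟩
  · intro a v ha hav
    obtain ⟨b, hb, hb'⟩ := h.inn a v ha hav
    exact ⟨b, hle _ _ hb, hb'⟩

theorem MaxRel.inn_of_common (hS : Coloring G Γ S col) (hm : MaxRel G Γ S col Q)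
    (hc : col y = col y') (h1 : Q x y) (h2 : Q x y') (h3 : Q z y') : Q z y :=
  MaxRel.out_of_common (Q := fun x y => Q y x) hS hm.flip hc h1 h2 h3

end Tripartite

/-! ### Three-coloured graphs in which twins share all neighbours -/

namespace TwinGraph

variable {V : Type u} {H : V → V → Prop} {col : V → Fin 3} {side : V → Bool}

/-- A graph with a proper three-colouring and a bipartition in which all vertices have neighbours
of both other colours, and vertices of the same colour with a common neighbour are twins. -/
structure IsTwin (H : V → V → Prop) (col : V → Fin 3) (side : V → Bool) : Prop where
  symm : ∀ {x y}, H x y → H y x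
  ne : ∀ {x y}, H x y → col x ≠ col y
  side_eq : ∀ {x y}, H x y → side y = !side x
  exists_nbr : ∀ x c, col x ≠ c → ∃ y, H x y ∧ col y = c
  twin : ∀ {x y y' z}, col y = col y' → H y x → H y' x → H y' z → H y z

/-- The classes of twins are arranged in cycles (or two-way infinite paths). -/
theorem IsTwin.exists_perm (h : IsTwin H col side) :
    ∃ (K : Type u) (κ : V → K) (τ : Equiv.Perm K) (c : K → Fin 3) (s : K → Bool),
      Function.Surjective κ ∧ (∀ x, s (κ x) = side x) ∧
      (∀ k, c (τ k) = c k + 1) ∧ (∀ k, s (τ k) = !s k) ∧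
      ∀ x y, H x y ↔ κ y = τ (κ x) ∨ κ y = τ⁻¹ (κ x) := by
  have ne1 : ∀ a : Fin 3, a ≠ a + 1 := by decide
  have ne2 : ∀ a : Fin 3, a ≠ a - 1 := by decide
  let E : Setoid V := ⟨fun x y => col x = col y ∧ ∃ z, H x z ∧ H y z,
    fun x => by
      obtain ⟨z, hz, -⟩ := h.exists_nbr x _ (ne1 _)
      exact ⟨rfl, z, hz, hz⟩,
    fun ⟨h1, z, h2, h3⟩ => ⟨h1.symm, z, h3, h2⟩,
    fun ⟨h1, z, h2, h3⟩ ⟨h4, w, h5, h6⟩ => ⟨h1.trans h4, w, h.twin h1 h2 h3 h5, h6⟩⟩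
  -- All neighbours of `x` of a given colour are twins, with `x` as common neighbour. So raising the
  -- colour by one is well defined on classes, with lowering as its inverse.
  choose up hup hupc using fun x => h.exists_nbr x _ (ne1 (col x))
  choose dn hdn hdnc using fun x => h.exists_nbr x _ (ne2 (col x))
  have hE : ∀ {x y}, E x y ↔ col x = col y ∧ ∃ z, H x z ∧ H y z := Iff.rfl
  have hup' : ∀ x y, E x y → E (up x) (up y) := fun x y ⟨h1, z, h2, h3⟩ =>
    ⟨by rw [hupc, hupc, h1], x, h.symm (hup x), h.symm (h.twin h1 h2 h3 (hup y))⟩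
  have hdn' : ∀ x y, E x y → E (dn x) (dn y) := fun x y ⟨h1, z, h2, h3⟩ =>
    ⟨by rw [hdnc, hdnc, h1], x, h.symm (hdn x), h.symm (h.twin h1 h2 h3 (hdn y))⟩
  let τ : Equiv.Perm (Quotient E) :=
    { toFun := Quotient.map up hup'
      invFun := Quotient.map dn hdn'
      left_inv := by
        rintro ⟨x⟩
        exact Quotient.sound ⟨by rw [hdnc, hupc, add_sub_cancel_right], up x, h.symm (hdn _), hup x⟩
      right_inv := by
        rintro ⟨x⟩
        exact Quotient.sound ⟨by rw [hupc, hdnc, sub_add_cancel], dn x, h.symm (hup _), hdn x⟩ }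
  refine ⟨Quotient E, Quotient.mk E, τ, Quotient.lift col fun x y hxy => hxy.1,
    Quotient.lift side ?_, Quotient.mk_surjective, fun x => rfl, ?_, ?_, ?_⟩
  · rintro x y ⟨h1, z, h2, h3⟩
    have := (h.side_eq h2).symm.trans (h.side_eq h3)
    simpa using this
  · rintro ⟨x⟩
    exact hupc x
  · rintro ⟨x⟩
    exact h.side_eq (hup x)
  · intro x y
    have e1 : Quotient.mk E y = τ (Quotient.mk E x) ↔ E y (up x) := Quotient.eq
    have e2 : Quotient.mk E y = τ⁻¹ (Quotient.mk E x) ↔ E y (dn x) := Quotient.eq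
    rw [e1, e2]
    constructor
    · intro hxy
      have key : ∀ a b : Fin 3, a ≠ b → b = a + 1 ∨ b = a - 1 := by decide
      rcases key _ _ (h.ne hxy) with h1 | h1
      · exact .inl ⟨by rw [h1, hupc], x, h.symm hxy, h.symm (hup x)⟩
      · exact .inr ⟨by rw [h1, hdnc], x, h.symm hxy, h.symm (hdn x)⟩
    · rintro (⟨h1, z, h2, h3⟩ | ⟨h1, z, h2, h3⟩)
      · exact h.symm (h.twin h1 h2 h3 (h.symm (hup x)))
      · exact h.symm (h.twin h1 h2 h3 (h.symm (hdn x)))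

end TwinGraph

/-! ### Alternating walks around the cycle of twin classes -/

namespace Tripartite

open RelStr

variable {A : Type u} {G : Type v} [Group G] [MulAction G A] {Γ : RelStr A} {S : A → Prop}
  {col : A → Fin 3} {Q : A → A → Prop}

/-- The relation `Q` or its converse. -/
def Arc (Q : A → A → Prop) : Bool → A → A → Prop
  | true => Q
  | false => fun x y => Q y x

/-- The side on which an alternating walk of length `m` ends. -/
def endSide : ℕ → Bool
  | 0 => true
  | m + 1 => !endSide m

/-- Two vertices are connected by an alternating walk of length `m + 1`. -/
def Alt (Q : A → A → Prop) : ℕ → A → A → Prop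
  | 0 => Q
  | m + 1 => Relation.Comp (Alt Q m) (Arc Q (endSide (m + 1)))

theorem Rel.pp_alt (h : Rel G Γ S col Q) (m : ℕ) : Γ.PP2 (Alt Q m) := by
  induction m with
  | zero => exact h.pp
  | succ m ih =>
    refine ih.comp ?_
    cases endSide (m + 1)
    exacts [h.pp.flip, h.pp]

theorem Rel.inv_alt (h : Rel G Γ S col Q) (m : ℕ) : Inv2 G (Alt Q m) := by
  induction m with
  | zero => exact h.inv
  | succ m ih =>
    refine ih.comp ?_
    cases endSide (m + 1)
    exacts [h.inv.flip, h.inv]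

theorem Rel.arc_right (h : Rel G Γ S col Q) {b : Bool} {x y : A} (hxy : Arc Q b x y) : S y := by
  cases b
  exacts [h.left hxy, h.right hxy]

theorem Rel.alt_right (h : Rel G Γ S col Q) {m : ℕ} {x y : A} (hxy : Alt Q m x y) : S y := by
  cases m with
  | zero => exact h.right hxy
  | succ m =>
    obtain ⟨w, -, hw⟩ := hxy
    exact h.arc_right hw

/-- `Q` need not be symmetric on vertices, so its bipartite double is used: the copy `true` acts as
a source, `false` as a target. -/
theorem MaxRel.isTwin (hS : Coloring G Γ S col) (hm : MaxRel G Γ S col Q) :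
    TwinGraph.IsTwin (fun x y : {x // S x} × Bool => Arc Q x.2 x.1 y.1 ∧ y.2 = !x.2)
      (fun x => col x.1) (fun x => x.2) := by
  have h := hm.1
  refine ⟨?_, ?_, fun hxy => hxy.2, ?_, ?_⟩
  · rintro ⟨x, _ | _⟩ ⟨y, _ | _⟩ ⟨h1, h2⟩
    exacts [by simp at h2, ⟨h1, rfl⟩, ⟨h1, rfl⟩, by simp at h2]
  · rintro ⟨x, _ | _⟩ ⟨y, b⟩ ⟨h1, h2⟩
    exacts [(h.ne h1).symm, h.ne h1]
  · rintro ⟨x, _ | _⟩ c hc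
    · obtain ⟨y, h1, h2⟩ := h.inn x.1 c x.2 hc
      exact ⟨(⟨y, h.left h1⟩, true), ⟨h1, rfl⟩, h2⟩
    · obtain ⟨y, h1, h2⟩ := h.out x.1 c x.2 hc
      exact ⟨(⟨y, h.right h1⟩, false), ⟨h1, rfl⟩, h2⟩
  · rintro ⟨x, b⟩ ⟨y, c⟩ ⟨y', c'⟩ ⟨z, d⟩ hc ⟨h1, h2⟩ ⟨h3, h4⟩ ⟨h5, h6⟩
    obtain rfl : c = c' := by simpa using h2.symm.trans h4
    refine ⟨?_, h6⟩
    cases c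
    exacts [MaxRel.inn_of_common (Q := Q) hS hm hc h1 h3 h5,
      MaxRel.out_of_common (Q := Q) hS hm hc h1 h3 h5]

theorem endSide_eq (m : ℕ) : endSide m = decide (Even m) := by
  induction m with
  | zero => simp [endSide]
  | succ m ih => by_cases h : Even m <;> simp [endSide, ih, h, Nat.even_add_one]

/-- The vertices reached by alternating walks, in terms of the cyclic arrangement of the classes
of twins. -/
theorem Rel.alt_iff (h : Rel G Γ S col Q) {K : Type u} {κ : {x // S x} × Bool → K}
    {τ : Equiv.Perm K} {s : K → Bool} (hκ : Function.Surjective κ) (hs : ∀ x, s (κ x) = x.2)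
    (hsτ : ∀ k, s (τ k) = !s k)
    (hH : ∀ x y : {x // S x} × Bool, (Arc Q x.2 x.1 y.1 ∧ y.2 = !x.2) ↔
      κ y = τ (κ x) ∨ κ y = τ⁻¹ (κ x)) (m : ℕ) (x y : {x // S x}) :
    Alt Q m x y ↔ ∃ j : ℕ, j ≤ m + 1 ∧
      κ (y, endSide (m + 1)) = (τ ^ ((m : ℤ) + 1 - 2 * j)) (κ (x, true)) := by
  have hH' : ∀ (x y : {x // S x}) b, Arc Q b x y ↔
      κ (y, !b) = τ (κ (x, b)) ∨ κ (y, !b) = τ⁻¹ (κ (x, b)) := fun x y b => by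
    rw [← hH]
    simp
  induction m generalizing y with
  | zero =>
    refine (hH' x y true).trans ⟨?_, ?_⟩
    · rintro (h1 | h1)
      · exact ⟨0, by simp, by simpa [endSide] using h1⟩
      · exact ⟨1, by simp, by simpa [endSide] using h1⟩
    · rintro ⟨j, hj, h1⟩
      rcases (by omega : j = 0 ∨ j = 1) with rfl | rfl
      · exact .inl (by simpa [endSide] using h1)
      · exact .inr (by simpa [endSide] using h1)
  | succ m ih =>
    have e1 : ∀ a : ℤ, τ ((τ ^ a) (κ (x, true))) = (τ ^ (1 + a)) (κ (x, true)) := fun a => by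
      rw [zpow_add, zpow_one, Equiv.Perm.mul_apply]
    have e2 : ∀ a : ℤ, τ⁻¹ ((τ ^ a) (κ (x, true))) = (τ ^ (-1 + a)) (κ (x, true)) := fun a => by
      rw [zpow_add, zpow_neg_one, Equiv.Perm.mul_apply]
    constructor
    · rintro ⟨w, h1, h2⟩
      obtain ⟨j, hj, h3⟩ := (ih ⟨w, h.alt_right h1⟩).1 h1
      rcases (hH' ⟨w, h.alt_right h1⟩ y _).1 h2 with h4 | h4 <;> rw [h3] at h4
      · exact ⟨j, by omega, h4.trans ((e1 _).trans (by push_cast; congr 2; ring))⟩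
      · exact ⟨j + 1, by omega, h4.trans ((e2 _).trans (by push_cast; congr 2; ring))⟩
    -- Adjacency depends only on classes, so any representative of the class before `y` continues
    -- the walk; its side is forced.
    · have key : ∀ k, (κ (y, endSide (m + 2)) = τ k ∨ κ (y, endSide (m + 2)) = τ⁻¹ k) →
          ∃ w : {x // S x}, κ (w, endSide (m + 1)) = k ∧ Arc Q (endSide (m + 1)) w y := by
        intro k hk
        obtain ⟨⟨w, b⟩, rfl⟩ := hκ k
        have h1 := hs (y, endSide (m + 2))
        obtain rfl : b = endSide (m + 1) := by
          rcases hk with hk | hk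
          · rw [hk, hsτ, hs] at h1
            simpa [endSide] using h1
          · have h2 := hsτ (κ (y, endSide (m + 2)))
            rw [h1, hk, show τ (τ⁻¹ (κ (w, b))) = κ (w, b) from τ.apply_symm_apply _, hs] at h2
            simpa [endSide] using h2
        exact ⟨w, rfl, (hH' w y _).2 hk⟩
      rintro ⟨j, hj, h1⟩
      rcases (by omega : j ≤ m + 1 ∨ j = m + 2) with hj | rfl
      · obtain ⟨w, h2, h3⟩ := key ((τ ^ ((m : ℤ) + 1 - 2 * j)) (κ (x, true)))
          (.inl (h1.trans ((by push_cast; congr 2; ring : _ = _).trans (e1 _).symm)))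
        exact ⟨w, (ih w).2 ⟨j, hj, h2⟩, h3⟩
      · obtain ⟨w, h2, h3⟩ := key ((τ ^ ((m : ℤ) + 1 - 2 * (m + 1 : ℕ))) (κ (x, true)))
          (.inr (h1.trans ((by push_cast; congr 2; ring : _ = _).trans (e2 _).symm)))
        exact ⟨w, (ih w).2 ⟨m + 1, le_rfl, h2⟩, h3⟩

/-- A tripartite relation pp-interprets `OR(=, =)`. -/
theorem pPInterprets_relOR (hfin : {r : A → A → Prop | Inv2 G r}.Finite)
    (hS : Coloring G Γ.withParameters S col) (hQ : Rel G Γ.withParameters S col Q)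
    {a : A} (ha : S a) :
    Γ.withParameters.PPInterprets 1
      ({⟨2 + 2, relOR (⊥ : Setoid Bool).toRel (⊥ : Setoid Bool).toRel⟩} : RelStr Bool) := by
  obtain ⟨Q, hm⟩ := exists_maxRel hfin hQ
  have h := hm.1
  obtain ⟨K, κ, τ, c, s, hκ, hs, hcτ, hsτ, hH⟩ := (hm.isTwin hS).exists_perm
  have halt := h.alt_iff hκ hs hsτ hH
  set k := κ (⟨a, ha⟩, true) with hk
  have hsz : ∀ m : ℕ, s ((τ ^ m) k) = endSide m := by
    intro m
    induction m with
    | zero => exact hs _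
    | succ m ih => rw [pow_succ', Equiv.Perm.mul_apply, hsτ, ih, endSide]
  have hcz : ∀ m : ℕ, (c ((τ ^ m) k)).val = ((c k).val + m) % 3 := by
    intro m
    induction m with
    | zero =>
      have := (c k).2
      simp only [pow_zero, Equiv.Perm.one_apply]
      omega
    | succ m ih =>
      rw [pow_succ', Equiv.Perm.mul_apply, hcτ, Fin.val_add, ih]
      simp only [Fin.val_one]
      omega
  have hrep : ∀ m : ℕ, ∃ y : {x // S x}, κ (y, endSide m) = (τ ^ m) k := by
    intro m
    obtain ⟨⟨y, b⟩, hy⟩ := hκ ((τ ^ m) k)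
    have h1 := hs (y, b)
    rw [hy, hsz] at h1
    exact ⟨y, h1 ▸ hy⟩
  -- Two alternating walk relations of different even lengths coincide, by finiteness. The class `2
  -- * q + 2` steps ahead is then also reached in only `2 * p + 2` steps, so the classes repeat.
  have hpos : 0 < Function.minimalPeriod (τ • ·) k := by
    have : Finite {r : A → A → Prop | Inv2 G r} := hfin
    obtain ⟨p, q, hpq, he⟩ : ∃ p q : ℕ, p < q ∧ Alt Q (2 * p + 1) = Alt Q (2 * q + 1) := by
      obtain ⟨p, q, hpq, he⟩ := Finite.exists_ne_map_eq_of_infinite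
        fun p : ℕ => (⟨Alt Q (2 * p + 1), h.inv_alt _⟩ : {r : A → A → Prop | Inv2 G r})
      have he := congrArg Subtype.val he
      rcases lt_or_gt_of_ne hpq with hpq | hpq
      exacts [⟨p, q, hpq, he⟩, ⟨q, p, hpq, he.symm⟩]
    obtain ⟨y, hy⟩ := hrep (2 * q + 2)
    have h1 : Alt Q (2 * p + 1) a y := by
      rw [he]
      exact (halt _ ⟨a, ha⟩ y).2 ⟨0, by simp, by
        rw [hy, ← zpow_natCast]
        congr 2⟩
    obtain ⟨j, hj, h2⟩ := (halt _ ⟨a, ha⟩ y).1 h1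
    have h3 : endSide (2 * p + 1 + 1) = endSide (2 * q + 2) := by
      simp [endSide_eq, Nat.even_add, parity_simps]
    rw [h3, hy, ← zpow_natCast, ← hk] at h2
    have h4 : (τ ^ ((2 * (q - p) + 2 * j : ℕ) : ℤ)) k = k := by
      have h5 : ((2 * (q - p) + 2 * j : ℕ) : ℤ) =
          -(((2 * p + 1 : ℕ) : ℤ) + 1 - 2 * j) + ((2 * q + 2 : ℕ) : ℤ) := by
        push_cast [Nat.cast_sub hpq.le]
        ring
      rw [h5, zpow_add, Equiv.Perm.mul_apply, h2, ← Equiv.Perm.mul_apply, ← zpow_add]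
      simp
    rw [zpow_natCast] at h4
    refine Function.IsPeriodicPt.minimalPeriod_pos (n := 2 * (q - p) + 2 * j) (by omega) ?_
    rw [Function.IsPeriodicPt, Function.IsFixedPt, smul_iterate]
    exact h4
  have hper : ∀ p q : ℤ, (τ ^ p) k = (τ ^ q) k ↔
      (Function.minimalPeriod (τ • ·) k : ℤ) ∣ p - q := by
    intro p q
    rw [← MulAction.zpow_smul_eq_iff_minimalPeriod_dvd, sub_eq_neg_add, zpow_add, mul_smul,
      zpow_neg, inv_smul_eq_iff]
    rfl
  have hfix : (τ ^ Function.minimalPeriod (τ • ·) k) k = k := by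
    have := (hper (Function.minimalPeriod (τ • ·) k) 0).2 (by simp)
    simpa using this
  generalize Function.minimalPeriod (τ • ·) k = p at *
  -- Sides alternate and colours advance by one modulo 3, so the period is a positive multiple of 6.
  obtain ⟨n, rfl, hn⟩ : ∃ n, p = 2 * n ∧ 3 ≤ n := by
    have h1 := hsz p
    rw [hfix, hk, hs, endSide_eq] at h1
    obtain ⟨n, hn⟩ : Even p := by simpa using h1.symm
    have h2 := hcz p
    rw [hfix] at h2
    have h3 := (c k).2
    exact ⟨n, by omega, by omega⟩
  have hinj : ∀ {p q : ℤ} {i j : Fin n}, p = 2 * i + q → (τ ^ p) k = (τ ^ (2 * (j : ℤ) + q)) k →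
      i = j := by
    intro p q i j hp he
    obtain ⟨d, hd⟩ := (hper _ _).1 he
    have h1 : ((i : ℤ) - j) = n * d := by
      subst hp
      push_cast at hd
      linarith
    have hi := i.2
    have hj := j.2
    have h2 := Int.eq_zero_of_abs_lt_dvd (m := n) ⟨d, h1⟩ (by rw [abs_lt]; omega)
    ext
    omega
  have hmod : ∀ p : ℤ, ∃ (i : Fin n) (d : ℤ), p = n * d + i := by
    intro p
    have h1 := Int.emod_nonneg p (b := n) (by omega)
    have h2 := Int.emod_lt_of_pos p (b := n) (by omega)
    refine ⟨⟨(p % n).toNat, by omega⟩, p / n, ?_⟩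
    simp only [Int.toNat_of_nonneg h1]
    exact (Int.mul_ediv_add_emod p n).symm
  have hadd : ∀ p q : ℤ, (τ ^ p) ((τ ^ q) k) = (τ ^ (p + q)) k := fun p q => by
    rw [zpow_add, Equiv.Perm.mul_apply]
  have hsn : endSide (2 * n - 1 + 1) = true := by
    rw [Nat.sub_add_cancel (by omega)]
    simp [endSide_eq]
  have hsn' : endSide (n - 3 + 1) = endSide n := by
    obtain ⟨m, rfl⟩ : ∃ m, n = m + 3 := ⟨n - 3, by omega⟩
    simp [endSide]
  have hrep' : ∀ (m : ℕ) b, endSide m = b → ∃ (y : A) (hy : S y),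
      κ (⟨y, hy⟩, b) = (τ ^ (m : ℤ)) k := by
    rintro m _ rfl
    obtain ⟨⟨y, hy⟩, h1⟩ := hrep m
    exact ⟨y, hy, h1⟩
  -- `Alt Q m` has walks of length `m + 1`. Length `2 * n` from `a` reaches all even positions.
  -- Length `n - 2` from position `2 * i` reaches the positions `2 * j + n` with `j = i - 1 - q`, `0
  -- ≤ q ≤ n - 2`, that is, all except `j = i` modulo `n`.
  refine pPInterprets_relOR_of_coMatching hn
    (Z := fun y z => Alt Q (2 * n - 1) a y ∧ Alt Q (n - 3) y z)
    (fun _ i j => (PP2.left (h.pp_alt _) a i).and (h.pp_alt _ i j))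
    (T := fun i y => ∃ hy, κ (⟨y, hy⟩, true) = (τ ^ (2 * (i : ℤ) + 0)) k)
    (S := fun j z => ∃ hz, κ (⟨z, hz⟩, endSide n) = (τ ^ (2 * (j : ℤ) + n)) k) ?_ ?_ ?_ ?_ ?_
  · rintro i j y ⟨hy, h1⟩ ⟨_, h2⟩
    exact hinj rfl (h1.symm.trans h2)
  · rintro i j y ⟨hy, h1⟩ ⟨_, h2⟩
    exact hinj rfl (h1.symm.trans h2)
  · intro i
    simpa using hrep' (2 * i) true (by simp [endSide_eq])
  · intro j
    simpa using hrep' (2 * j + n) (endSide n) (by simp [endSide_eq, parity_simps])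
  intro y z
  constructor
  · rintro ⟨h1, h2⟩
    have sy := h.alt_right h1
    have sz := h.alt_right h2
    obtain ⟨p, hp, h3⟩ := (halt _ ⟨a, ha⟩ ⟨y, sy⟩).1 h1
    obtain ⟨q, hq, h4⟩ := (halt _ ⟨y, sy⟩ ⟨z, sz⟩).1 h2
    obtain ⟨i, d, hi⟩ := hmod (n - p)
    obtain ⟨j, e, hj⟩ := hmod (n - p - q - 1)
    rw [hsn, ← hk] at h3
    rw [h3, hadd, hsn'] at h4
    refine ⟨i, j, ?_, ⟨sy, h3.trans ((hper _ _).2 ⟨d, ?_⟩)⟩, sz, h4.trans ((hper _ _).2 ⟨e, ?_⟩)⟩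
    · rintro rfl
      have h5 : (q + 1 : ℤ) = n * (d - e) := by linarith
      have h6 := Int.le_of_dvd (by omega) ⟨_, h5⟩
      omega
    · push_cast [Nat.cast_sub (by omega : 1 ≤ 2 * n)]
      linarith
    · push_cast [Nat.cast_sub (by omega : 1 ≤ 2 * n), Nat.cast_sub hn]
      linarith
  · rintro ⟨i, j, hij, ⟨sy, h1⟩, sz, h2⟩
    have hi := i.2
    refine ⟨(halt _ ⟨a, ha⟩ ⟨y, sy⟩).2 ⟨n - i, by omega, ?_⟩,
      (halt _ ⟨y, sy⟩ ⟨z, sz⟩).2 ?_⟩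
    · rw [hsn, h1]
      congr 2
      push_cast [Nat.cast_sub (by omega : 1 ≤ 2 * n), Nat.cast_sub hi.le]
      ring
    · obtain ⟨q, d, hq⟩ := hmod (i - j - 1)
      refine ⟨q, ?_, ?_⟩
      · have hq' := q.2
        by_contra hc
        have h3 : (q : ℤ) = n - 1 := by omega
        refine hij (Fin.ext ?_)
        have h4 : ((i : ℤ) - j) = n * (d + 1) := by linarith
        have hj := j.2
        have h5 := Int.eq_zero_of_abs_lt_dvd (m := n) ⟨_, h4⟩ (by rw [abs_lt]; omega)
        omega
      · rw [hsn', h2, h1, hadd, hper]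
        refine ⟨-d, ?_⟩
        push_cast [Nat.cast_sub hn]
        linarith

end Tripartite

/-! ### Relations whose orbit graph is not bipartite -/

namespace OrbitGraph

open RelStr MulAction

variable {A : Type u} {G : Type v} [Group G] [MulAction G A] {Γ : RelStr A} {Q : A → A → Prop}

/-- The relation that `Q` induces on the orbits. -/
def N (G : Type v) [Group G] [MulAction G A] (Q : A → A → Prop) (o p : orbitRel.Quotient G A) :
    Prop :=
  ∃ a b, Quotient.mk _ a = o ∧ Quotient.mk _ b = p ∧ Q a b

/-- The non-isolated orbits. -/
def dom (G : Type v) [Group G] [MulAction G A] (Q : A → A → Prop) :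
    Set (orbitRel.Quotient G A) := {o | ∃ p, N G Q o p}

/-- A pp-definable invariant relation whose orbit graph is a non-bipartite loopless graph. -/
structure Admissible (G : Type v) [Group G] [MulAction G A] (Γ : RelStr A) (Q : A → A → Prop) :
    Prop where
  pp : Γ.PP2 Q
  inv : Inv2 G Q
  symm : ∀ {o p}, N G Q o p → N G Q p o
  irrefl : ∀ o, ¬ N G Q o o
  not_bip : ¬ ∃ χ : orbitRel.Quotient G A → Bool, ∀ o p, N G Q o p → χ o ≠ χ p

/-- The orbit of an element. -/
abbrev oc (G : Type v) [Group G] [MulAction G A] (x : A) : orbitRel.Quotient G A :=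
  Quotient.mk _ x

theorem oc_smul (g : G) (x : A) : oc G (g • x) = oc G x := Quotient.sound ⟨g, rfl⟩

theorem N.of_rel {x y : A} (h : Q x y) : N G Q (oc G x) (oc G y) := ⟨x, y, rfl, rfl, h⟩

theorem N.exists_out (hQ : Inv2 G Q) {x : A} {p : orbitRel.Quotient G A} (h : N G Q (oc G x) p) :
    ∃ y, oc G y = p ∧ Q x y := by
  obtain ⟨a, b, h1, rfl, h2⟩ := h
  obtain ⟨g, rfl⟩ := Quotient.exact h1.symm
  exact ⟨g • b, oc_smul _ _, hQ g _ _ h2⟩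

theorem N.exists_inn (hQ : Inv2 G Q) {x : A} {p : orbitRel.Quotient G A} (h : N G Q p (oc G x)) :
    ∃ y, oc G y = p ∧ Q y x := by
  obtain ⟨a, b, rfl, h1, h2⟩ := h
  obtain ⟨g, rfl⟩ := Quotient.exact h1.symm
  exact ⟨g • a, oc_smul _ _, hQ g _ _ h2⟩

theorem Admissible.comp_iff (h : Admissible G Γ Q) (o p : orbitRel.Quotient G A) :
    N G (Relation.Comp (Relation.Comp Q Q) Q) o p ↔ ∃ q r, N G Q o q ∧ N G Q q r ∧ N G Q r p := by
  constructor
  · rintro ⟨a, b, rfl, rfl, w, ⟨z, h1, h2⟩, h3⟩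
    exact ⟨_, _, .of_rel h1, .of_rel h2, .of_rel h3⟩
  · rintro ⟨q, r, h1, h2, h3⟩
    obtain ⟨a, rfl⟩ := Quotient.mk_surjective o
    obtain ⟨b, rfl, hab⟩ := h1.exists_out h.inv
    obtain ⟨c, rfl, hbc⟩ := h2.exists_out h.inv
    obtain ⟨d, rfl, hcd⟩ := h3.exists_out h.inv
    exact ⟨a, d, rfl, rfl, c, ⟨b, hab, hbc⟩, hcd⟩

/-- An admissible relation with the least possible number of non-isolated orbits, and the largest
possible number of edges between orbits subject to that. -/
theorem Admissible.exists_extremal [Finite (orbitRel.Quotient G A)]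
    (hfin : {r : A → A → Prop | Inv2 G r}.Finite) (h : Admissible G Γ Q) :
    ∃ Q, Admissible G Γ Q ∧
      (∀ Q', Admissible G Γ Q' → dom G Q' ⊆ dom G Q → dom G Q' = dom G Q) ∧
      (∀ Q', Admissible G Γ Q' → dom G Q' = dom G Q → (∀ o p, N G Q o p → N G Q' o p) →
        ∀ o p, N G Q' o p → N G Q o p) := by
  have hf : {r | Admissible G Γ r}.Finite := hfin.subset fun r hr => hr.inv
  obtain ⟨Q₁, h₁, hmin⟩ := Set.exists_min_image _ (fun r => (dom G r).ncard) hf ⟨Q, h⟩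
  obtain ⟨Q₂, ⟨h₂, hd⟩, hmax⟩ := Set.exists_max_image {r | Admissible G Γ r ∧ dom G r = dom G Q₁}
    (fun r => {e : orbitRel.Quotient G A × orbitRel.Quotient G A | N G r e.1 e.2}.ncard)
    (hf.subset fun r hr => hr.1) ⟨Q₁, h₁, rfl⟩
  refine ⟨Q₂, h₂, fun Q' h' hle => ?_, fun Q' h' he hle o p hop => ?_⟩
  · rw [hd] at hle ⊢
    exact Set.eq_of_subset_of_ncard_le hle (hmin Q' h') (Set.toFinite _)
  · have := Set.eq_of_subset_of_ncard_le (fun e he => hle e.1 e.2 he)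
      (hmax Q' ⟨h', he.trans hd⟩) (Set.toFinite _)
    exact this.ge (show (o, p) ∈ _ from hop)

/-- Without a triangle, the threefold composition of `Q` is still loopless, so edge-maximality makes
the orbit graph closed under 3-walks. Every odd walk then shortens to an edge, and an odd closed
walk would give a loop. -/
theorem Admissible.exists_triangle (h : Admissible G Γ Q)
    (hmax : ∀ Q', Admissible G Γ Q' → dom G Q' = dom G Q → (∀ o p, N G Q o p → N G Q' o p) →
        ∀ o p, N G Q' o p → N G Q o p) :
    ∃ a b c, N G Q a b ∧ N G Q a c ∧ N G Q b c := by
  by_contra hc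
  have hle : ∀ o p, N G Q o p → N G (Relation.Comp (Relation.Comp Q Q) Q) o p := fun o p hop =>
    (h.comp_iff o p).2 ⟨p, o, hop, h.symm hop, hop⟩
  have h' : Admissible G Γ (Relation.Comp (Relation.Comp Q Q) Q) := by
    refine ⟨(h.pp.comp h.pp).comp h.pp, (h.inv.comp h.inv).comp h.inv, fun {o p} hop => ?_,
      fun o ho => ?_, fun ⟨χ, hχ⟩ => h.not_bip ⟨χ, fun o p hop => hχ o p (hle o p hop)⟩⟩
    · obtain ⟨q, r, h1, h2, h3⟩ := (h.comp_iff o p).1 hop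
      exact (h.comp_iff p o).2 ⟨r, q, h.symm h3, h.symm h2, h.symm h1⟩
    · obtain ⟨q, r, h1, h2, h3⟩ := (h.comp_iff o o).1 ho
      exact hc ⟨o, q, r, h1, h.symm h3, h2⟩
  have hdom : dom G (Relation.Comp (Relation.Comp Q Q) Q) = dom G Q := by
    ext o
    constructor
    · rintro ⟨p, hp⟩
      obtain ⟨q, r, h1, -, -⟩ := (h.comp_iff o p).1 hp
      exact ⟨q, h1⟩
    · rintro ⟨p, hp⟩
      exact ⟨p, hle o p hp⟩
  have key : ∀ {o p q r}, N G Q o q → N G Q q r → N G Q r p → N G Q o p :=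
    fun {o p q r} h1 h2 h3 => hmax _ h' hdom hle o p ((h.comp_iff o p).2 ⟨q, r, h1, h2, h3⟩)
  let H : SimpleGraph (orbitRel.Quotient G A) := ⟨N G Q, ⟨fun _ _ => h.symm⟩, ⟨h.irrefl⟩⟩
  have hw : ∀ {o p} (w : H.Walk o p), (Odd w.length → N G Q o p) ∧
      ∀ q, N G Q q o → Even w.length → N G Q q p := by
    intro o p w
    induction w with
    | nil => exact ⟨by simp, fun q hq _ => hq⟩
    | @cons a b c hab w ih =>
      have hab : N G Q a b := hab
      constructor
      · intro hodd
        refine ih.2 a hab ?_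
        simpa [Nat.odd_add_one] using hodd
      · intro q hq hev
        have hodd : Odd w.length := by simpa [Nat.even_add_one] using hev
        exact key hq hab (ih.1 hodd)
  have h2 : H.Colorable 2 := by
    rw [SimpleGraph.two_colorable_iff_forall_loop_even]
    intro o w
    by_contra hodd
    exact h.irrefl o ((hw w).1 (by simpa using hodd))
  obtain ⟨c⟩ := h2
  refine h.not_bip ⟨fun o => decide (c o = 0), fun o p hop => ?_⟩
  have h3 : c o ≠ c p := c.valid (show H.Adj o p from hop)
  have key : ∀ a b : Fin 2, a ≠ b → decide (a = 0) ≠ decide (b = 0) := by decide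
  exact key _ _ h3

/-- The union of a set of non-isolated orbits. -/
def Mem (X : Set (dom G Q)) (x : A) : Prop := ∃ h : oc G x ∈ dom G Q, (⟨oc G x, h⟩ : dom G Q) ∈ X

theorem Mem.smul {X : Set (dom G Q)} {x : A} (h : Mem X x) (g : G) : Mem X (g • x) := by
  obtain ⟨h1, h2⟩ := h
  unfold Mem
  simp only [oc_smul]
  exact ⟨h1, h2⟩

theorem mem_of_eq {X : Set (dom G Q)} {x : A} {i : dom G Q} (h : oc G x = i) (hi : i ∈ X) :
    Mem X x := by
  obtain ⟨i, hi'⟩ := i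
  subst h
  exact ⟨hi', hi⟩

/-- The orbit graph of an extremal relation, together with the pp-definable unions of orbits. -/
theorem Admissible.tame (h : Admissible G Γ Q)
    (hmin : ∀ Q', Admissible G Γ Q' → dom G Q' ⊆ dom G Q → dom G Q' = dom G Q)
    (htri : ∃ a b c, N G Q a b ∧ N G Q a c ∧ N G Q b c)
    (horb : ∀ o : orbitRel.Quotient G A, Γ.PP1 fun x => oc G x = o) :
    DefinableGraph.Tame (fun i j : dom G Q => N G Q i j) {X | Γ.PP1 (Mem X)} := by
  have lift : ∀ {x} {i j : dom G Q}, oc G x = i → N G Q i j → ∃ y, oc G y = j ∧ Q x y :=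
    fun hx hij => N.exists_out h.inv (hx ▸ hij)
  have lift' : ∀ {x} {i j : dom G Q}, oc G x = i → N G Q i j → ∃ y, oc G y = j ∧ Q y x :=
    fun hx hij => N.exists_inn h.inv (hx ▸ h.symm hij)
  refine ⟨h.symm, fun i => h.irrefl i, ?_, ?_, ?_, ?_, ?_, ?_⟩
  · intro i
    refine (horb i).congr fun x => ⟨fun hx => mem_of_eq hx rfl, fun ⟨h1, h2⟩ => ?_⟩
    exact congrArg Subtype.val h2
  · intro X Y hX hY
    exact (PP1.and hX hY).congr fun x => ⟨fun ⟨⟨h1, h2⟩, _, h3⟩ => ⟨h1, h2, h3⟩,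
      fun ⟨h1, h2, h3⟩ => ⟨⟨h1, h2⟩, h1, h3⟩⟩
  · intro X hX
    have : Γ.PP1 fun x => ∃ y, Mem X y ∧ Q y x := fun _ _ => .ex ((hX _).and (h.pp _ _))
    refine this.congr fun x => ⟨?_, ?_⟩
    · rintro ⟨y, ⟨h1, h2⟩, h3⟩
      exact ⟨⟨_, h.symm (.of_rel h3)⟩, ⟨_, h2, .of_rel h3⟩⟩
    · rintro ⟨h1, i, hi, h2⟩
      obtain ⟨y, h3, h4⟩ := N.exists_inn h.inv h2
      exact ⟨y, mem_of_eq h3 hi, h4⟩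
  · intro L₀ L₁ L₂ L₃ h₀ h₁ h₂ h₃
    -- The arcs alternate in direction, so the degenerate walks with `w = y` or `z = x` lift
    -- although `Q` need not be symmetric.
    let F : A → Prop := fun x => Mem L₀ x ∧ ∃ y z w, (Mem L₁ y ∧ Mem L₂ z ∧ Mem L₃ w) ∧
      Q x y ∧ Q z y ∧ Q z w ∧ Q x w
    have hF : Γ.PP1 F := fun _ _ => (h₀ _).and (.ex (.ex (.ex (((h₁ _).and ((h₂ _).and (h₃ _))).and
      ((h.pp _ _).and ((h.pp _ _).and ((h.pp _ _).and (h.pp _ _))))))))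
    have hinv : ∀ (g : G) x, F x → F (g • x) := by
      rintro g x ⟨h1, y, z, w, ⟨h2, h3, h4⟩, h5, h6, h7, h8⟩
      exact ⟨h1.smul g, g • y, g • z, g • w, ⟨h2.smul g, h3.smul g, h4.smul g⟩, h.inv g _ _ h5,
        h.inv g _ _ h6, h.inv g _ _ h7, h.inv g _ _ h8⟩
    refine ⟨{i | ∃ x, oc G x = i ∧ F x}, hF.congr fun x => ⟨fun hx => ?_, ?_⟩, ?_, ?_, ?_⟩
    · exact ⟨hx.1.1, x, rfl, hx⟩
    · rintro ⟨h1, y, h2, h3⟩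
      obtain ⟨g, rfl⟩ := Quotient.exact h2
      simpa using hinv g⁻¹ _ h3
    · rintro i ⟨x, hx, ⟨_, h0⟩, y, z, w, ⟨⟨_, h2⟩, ⟨_, h3⟩, ⟨_, h4⟩⟩, h5, h6, h7, h8⟩
      obtain ⟨i, hi⟩ := i
      subst hx
      exact ⟨h0, _, h2, _, h3, _, h4, .of_rel h5, h.symm (.of_rel h6), .of_rel h7,
        h.symm (.of_rel h8)⟩
    · intro i j k h1 h2 h3 h4 h5 h6
      obtain ⟨x, hx⟩ := Quotient.mk_surjective i.1
      obtain ⟨y, hy, hxy⟩ := lift hx h5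
      obtain ⟨z, hz, hzy⟩ := lift' hy h6
      exact ⟨x, hx, mem_of_eq hx h1, y, z, y, ⟨mem_of_eq hy h2, mem_of_eq hz h4, mem_of_eq hy h3⟩,
        hxy, hzy, hzy, hxy⟩
    · intro i j l h1 h2 h3 h4 h5 h6
      obtain ⟨x, hx⟩ := Quotient.mk_surjective i.1
      obtain ⟨y, hy, hxy⟩ := lift hx h5
      obtain ⟨w, hw, hxw⟩ := lift hx h6
      exact ⟨x, hx, mem_of_eq hx h1, y, x, w, ⟨mem_of_eq hy h3, mem_of_eq hx h2, mem_of_eq hw h4⟩,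
        hxy, hxy, hxw, hxw⟩
  · intro X hX
    -- If the restriction to `X` is not bipartite, it is admissible, and minimality forbids losing
    -- any non-isolated orbit.
    let Q' : A → A → Prop := fun x y => Q x y ∧ Mem X x ∧ Mem X y
    have hle : ∀ {o p}, N G Q' o p → N G Q o p :=
      fun ⟨a, b, h1, h2, h3⟩ => ⟨a, b, h1, h2, h3.1⟩
    have hN : ∀ {i j : dom G Q}, i ∈ X → j ∈ X → N G Q i j → N G Q' i j := by
      rintro i j hi hj ⟨a, b, h1, h2, h3⟩
      exact ⟨a, b, h1, h2, h3, mem_of_eq h1 hi, mem_of_eq h2 hj⟩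
    by_cases hb : ∃ χ : orbitRel.Quotient G A → Bool, ∀ o p, N G Q' o p → χ o ≠ χ p
    · obtain ⟨χ, hχ⟩ := hb
      exact .inr ⟨fun i => χ i, fun i hi j hj hij => hχ _ _ (hN hi hj hij)⟩
    · left
      have h' : Admissible G Γ Q' := by
        refine ⟨fun _ i j => (h.pp i j).and ((hX i).and (hX j)),
          fun g x y ⟨h1, h2, h3⟩ => ⟨h.inv g x y h1, h2.smul g, h3.smul g⟩, ?_,
          fun o ho => h.irrefl o (hle ho), hb⟩
        rintro o p ⟨a, b, rfl, rfl, h1, ⟨ha, ha'⟩, ⟨hb, hb'⟩⟩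
        exact hN (i := ⟨_, hb⟩) (j := ⟨_, ha⟩) hb' ha' (h.symm (.of_rel h1))
      have hd := hmin Q' h' fun o ⟨p, hp⟩ => ⟨p, hle hp⟩
      refine Set.eq_univ_of_forall fun i => ?_
      obtain ⟨p, a, b, h1, -, -, ⟨h2, h3⟩, -⟩ : (i : orbitRel.Quotient G A) ∈ dom G Q' :=
        hd.symm ▸ i.2
      obtain ⟨i, hi⟩ := i
      subst h1
      exact h3
  · obtain ⟨a, b, c, h1, h2, h3⟩ := htri
    exact ⟨⟨a, b, h1⟩, ⟨b, c, h3⟩, ⟨c, a, h.symm h2⟩, h1, h2, h3⟩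

/-- A relation whose orbit graph is a non-bipartite loopless graph pp-interprets `OR(=, =)`. -/
theorem Admissible.pPInterprets_relOR [Finite (orbitRel.Quotient G A)]
    (hfin : {r : A → A → Prop | Inv2 G r}.Finite)
    (horb : ∀ o : orbitRel.Quotient G A, Γ.withParameters.PP1 fun x => oc G x = o)
    (h : Admissible G Γ.withParameters Q) :
    Γ.withParameters.PPInterprets 1
      ({⟨2 + 2, relOR (⊥ : Setoid Bool).toRel (⊥ : Setoid Bool).toRel⟩} : RelStr Bool) := by
  classical
  obtain ⟨Q, h, hmin, hmax⟩ := h.exists_extremal hfin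
  obtain ⟨V, hV, hne, hcov, hdisj, hind, hsee⟩ :=
    (h.tame hmin (h.exists_triangle hmax) horb).exists_threeColoring
  choose c hc using hcov
  let S : A → Prop := fun x => oc G x ∈ dom G Q
  let col : A → Fin 3 := fun x => if hx : oc G x ∈ dom G Q then c ⟨oc G x, hx⟩ else 0
  have hcol : ∀ {x} (hx : S x) u, col x = u ↔ (⟨oc G x, hx⟩ : dom G Q) ∈ V u := by
    intro x hx u
    have h1 : col x = c ⟨oc G x, hx⟩ := dif_pos hx
    rw [h1]
    exact ⟨fun h2 => h2 ▸ hc _, fun h2 => hdisj _ _ _ (hc _) h2⟩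
  have hl : ∀ {x y}, Q x y → S x := fun hxy => ⟨_, .of_rel hxy⟩
  have hr : ∀ {x y}, Q x y → S y := fun hxy => ⟨_, h.symm (.of_rel hxy)⟩
  have hS : Tripartite.Coloring G Γ.withParameters S col := by
    refine ⟨fun u v => PP1.congr (hV u v) fun x => exists_prop.symm.trans ?_ |>.symm,
      fun g x hx => ?_, fun g x _ => ?_⟩
    · exact exists_congr fun hx => or_congr (hcol hx u) (hcol hx v)
    · simpa only [S, oc_smul] using hx
    · simp only [col, oc_smul]
  have hQ : Tripartite.Rel G Γ.withParameters S col Q := by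
    refine ⟨h.pp, h.inv, hl, hr, fun {x y} hxy hc => ?_, fun x v hx hv => ?_, fun x v hx hv => ?_⟩
    · exact hind _ _ _ ((hcol (hl hxy) _).1 rfl) ((hcol (hr hxy) _).1 hc.symm) (.of_rel hxy)
    · obtain ⟨j, hj, hN⟩ := hsee _ v hv _ ((hcol hx _).1 rfl)
      obtain ⟨y, hy, hxy⟩ := N.exists_out h.inv hN
      refine ⟨y, hxy, (hcol (hr hxy) v).2 ?_⟩
      convert hj
    · obtain ⟨j, hj, hN⟩ := hsee _ v hv _ ((hcol hx _).1 rfl)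
      obtain ⟨y, hy, hxy⟩ := N.exists_inn h.inv (h.symm hN)
      refine ⟨y, hxy, (hcol (hl hxy) v).2 ?_⟩
      convert hj
  obtain ⟨i, -⟩ := hne 0
  obtain ⟨a, ha⟩ := Quotient.mk_surjective i.1
  have hSa : oc G a ∈ dom G Q := by
    rw [oc, ha]
    exact i.2
  exact Tripartite.pPInterprets_relOR hfin hS hQ hSa

/-- A group with finitely many `2`-orbits has finitely many invariant binary relations. -/
theorem finite_inv2 (h : Finite (orbitRel.Quotient G (Fin 2 → A))) :
    {r : A → A → Prop | Inv2 G r}.Finite := by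
  refine Finite.of_injective (β := Set (orbitRel.Quotient G (Fin 2 → A)))
    (fun r => {q | ∃ x : Fin 2 → A, Quotient.mk _ x = q ∧ r.1 (x 0) (x 1)}) ?_
  have key : ∀ r s : {r : A → A → Prop | Inv2 G r},
      {q : orbitRel.Quotient G (Fin 2 → A) | ∃ x, Quotient.mk _ x = q ∧ r.1 (x 0) (x 1)} =
      {q | ∃ x, Quotient.mk _ x = q ∧ s.1 (x 0) (x 1)} → ∀ x y, r.1 x y → s.1 x y := by
    intro r s hrs x y hxy
    obtain ⟨z, h1, h2⟩ := hrs.subset ⟨![x, y], rfl, hxy⟩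
    obtain ⟨g, rfl⟩ := Quotient.exact h1
    simpa using s.2 g⁻¹ _ _ h2
  intro r s hrs
  ext x y
  exact ⟨key r s hrs x y, key s r hrs.symm x y⟩

theorem finite_orbits (h : Finite (orbitRel.Quotient G (Fin 2 → A))) :
    Finite (orbitRel.Quotient G A) := by
  refine Finite.of_surjective (Quotient.map' (s₁ := orbitRel G (Fin 2 → A)) (s₂ := orbitRel G A)
    (fun x => x 0) ?_) ?_
  · rintro _ x ⟨g, rfl⟩
    exact ⟨g, rfl⟩
  · rintro ⟨x⟩
    exact ⟨Quotient.mk _ fun _ => x, rfl⟩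

end OrbitGraph

theorem mainTheorem2 {A : Type u} (D : Digraph A) (hD : D.IsSmooth) (G : Subgroup D.Aut)
    (hG : D.FinitelyManyOrbits G 2) (hsymm : (D.orbitDigraph G).IsSymmetric)
    (hbip : ¬ (D.orbitDigraph G).IsBipartite) :
    (D.orbitDigraph G).HasLoop ∨
      ∃ (C : Type) (_ : Finite C) (α : Setoid C), α ≠ ⊤ ∧
        (D.withOrbits G).PPInterpretsWithParameters 1
          ({⟨2 + 2, relOR α.toRel α.toRel⟩} : RelStr C) := by
  refine or_iff_not_imp_left.2 fun hloop => ⟨Bool, inferInstance, ⊥, fun h => ?_, ?_⟩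
  · have : (⊥ : Setoid Bool) true false := h ▸ trivial
    exact Bool.noConfusion this
  · have := OrbitGraph.finite_orbits hG
    refine OrbitGraph.Admissible.pPInterprets_relOR (Q := D.Adj) (OrbitGraph.finite_inv2 hG)
      (fun o => ?_) ⟨RelStr.PP2.of_mem_withParameters (.inl rfl), fun g x y h => ?_,
        fun {o p} h => hsymm o p h, fun o h => hloop ⟨o, h⟩, hbip⟩
    · obtain ⟨a, rfl⟩ := Quotient.mk_surjective o
      exact (RelStr.PP1.of_mem_withParameters (p := fun x => x ∈ MulAction.orbit G a)
        (.inr ⟨a, rfl⟩)).congr fun x =>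
          ⟨fun h => Quotient.sound h, fun h => Quotient.exact h⟩
    · exact g.1.map_rel_iff.2 h
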